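/- Let $N$ be a smooth complete surface of revolution with rotation center $O$, radial diameter $s_0\in(0,\infty]$ and metric $ds^2+\Gamma(s)^2d\beta^2$ in geodesic polar coordinates $(s,\beta)$ about $O$. Here $\Gamma$ is smooth and odd, with $\Gamma(s)=0$ only at $s=0$ and $\Gamma'(0)=1$ if $s_0=\infty$; if $s_0<\infty$, $\Gamma$ is extended to be $2s_0$-periodic, its zeros are exactly $ns_0$ ($n\in\mathbb Z$), and $\Gamma'(ns_0)=(-1)^n$, $\Gamma''(ns_0)=0$. Let $\mathcal J$ be the complex structure with $\mathcal J\partial_s=\Gamma^{-1}\partial_\beta$, $D$ the Levi-Civita connection, and for $\mu,k,b,c\in\mathbb R$ put $$F(s)=\int_0^s\Gamma(s')\,ds',\qquad G=\tfrac{k^2}{2}\Gamma^2+bkF-k^2F^2 ,$$ regarded as functions on $N$. Suppose $\mu<0$ and $c^2<-4(bk+k^2)$. Let $W(a)\in N$, $a\in(0,\infty)$, be a $C^2$ solution of $$D_aW_a+\frac1aW_a+\frac1{a^2}\nabla G-\mu\nabla F+\frac ca\mathcal JW_a=0 \qquad (4.8)$$ that is not identically $O$ and satisfies $W(a)\to O$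 and $a|W_a(a)|\to0$ as $a\to0^+$. Let $(s(a),\beta(a))$ be differentiable polar coordinates along it, $W(a)=\exp_O(s(a),\beta(a))$ for $a>0$ (so $s$ may change sign when $W$ passes through $O$), and let $\sigma=\langle W_a,\mathcal J\partial_s\rangle=\Gamma(s)\beta_a$. If $\limsup_{a\to\infty}|s(a)|<s_0$, then there exist constants $\theta_0\in\mathbb R$, $E_\infty>0$ and a function $\theta(a)$ with $$\theta(a)=\theta_0-\sqrt{-\mu}\,a-\frac{\Gamma'''(0)E_\infty}{8\sqrt{-\mu}}\log a+O(a^{-1})$$ such that, as $a\to+\infty$, $$s(a)=\sqrt{\frac{-2E_\infty}{a\mu}}\cos\theta(a)+O(a^{-3/2}),\qquad s_a(a)=\sqrt{\frac{2E_\infty}{a}}\sin\theta(a)+O(a^{-3/2}),$$ $$\sigma(a)=-c\sqrt{\frac{-E_\infty}{2a^3\mu}}\cos\theta(a)+O(a^{-5/2}),$$ and $\sigma(a)=-\dfrac{cF(s(a))}{a\Gamma(s(a))}$ for all $a>0$ (where $F/\Gamma$ is read as its limit $0$ when $s(a)=0$). -/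

import Mathlib

open Filter Topology Asymptotics
open scoped ContDiff ENNReal

noncomputable section

/-- A smooth complete rotationally symmetric surface, given by its radial diameter
`radius = s₀ ∈ (0, ∞]` and by the function `Γ` of its metric `ds² + Γ(s)² dβ²` in geodesic polar
coordinates `(s, β)` about the rotation center, extended to an odd (and `2 s₀`-periodic, if
`s₀ < ∞`) function on `ℝ`. -/
structure RevolutionSurface where
  Γ : ℝ → ℝ
  radius : ℝ≥0∞
  radius_pos : 0 < radius
  smooth : ContDiff ℝ ∞ Γ
  odd : ∀ s, Γ (-s) = -Γ s
  periodic : radius ≠ ⊤ → Function.Periodic Γ (2 * radius.toReal)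
  eq_zero_iff : radius ≠ ⊤ → ∀ s, Γ s = 0 ↔ ∃ n : ℤ, s = n * radius.toReal
  deriv_pole : radius ≠ ⊤ → ∀ n : ℤ, deriv Γ (n * radius.toReal) = (-1) ^ n
  deriv_deriv_pole : radius ≠ ⊤ → ∀ n : ℤ, deriv (deriv Γ) (n * radius.toReal) = 0
  eq_zero_iff_of_top : radius = ⊤ → ∀ s, Γ s = 0 ↔ s = 0
  deriv_zero_of_top : radius = ⊤ → deriv Γ 0 = 1

namespace RevolutionSurface

variable (N : RevolutionSurface)

/-- `F(s) = ∫₀ˢ Γ`. -/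
def F (s : ℝ) : ℝ := ∫ t in (0 : ℝ)..s, N.Γ t

/-- `G(s) = (k²/2) Γ² + b k F - k² F²`. -/
def G (k b s : ℝ) : ℝ := k ^ 2 / 2 * N.Γ s ^ 2 + b * k * N.F s - k ^ 2 * N.F s ^ 2

/-- The point with polar coordinates `(s, β)`, recorded as `(F(s), Γ(s) e^{iβ}) ∈ ℝ × ℂ`.
As `F` is even, `2 s₀`-periodic and strictly increasing on `[0, s₀]`, two pairs `(s, β)` have the
same image exactly if they are polar coordinates of the same point of the surface; the image is a
smooth embedded copy of the surface (for `Γ = sin`, a translate of the unit sphere, for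
`Γ = sinh`, of the hyperboloid). Only the topology, not the metric, is taken from `ℝ × ℂ`. -/
def polar (s β : ℝ) : ℝ × ℂ := (N.F s, (N.Γ s : ℂ) * Complex.exp (β * Complex.I))

/-- The points of the surface. -/
abbrev Point : Type := {P : ℝ × ℂ // ∃ s β : ℝ, N.polar s β = P}

/-- `exp_O (s, β)`: the point with polar coordinates `(s, β)`. -/
def expO (s β : ℝ) : N.Point := ⟨N.polar s β, s, β, rfl⟩

/-- The rotation center `O`. -/
def origin : N.Point := N.expO 0 0

/-! ### Normal coordinates about a pole

The poles are the points with `s = p`, where `Γ p = 0`: the center `O` and, if `s₀ < ∞`, the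
point antipodal to it. A point `x ∈ ℂ` with `|x| < s₀` is the normal coordinate, about the pole,
of the point with polar coordinates `(p + |x|, arg x)`. The two charts cover the surface. -/

/-- The point with normal coordinate `x` about the pole `p`. -/
def normalChart (p : ℝ) (x : ℂ) : N.Point := N.expO (p + ‖x‖) x.arg

/-- The ratio `Γ(p + ρ) / ρ`, with its limit value `Γ'(p)` at `ρ = 0`. -/
def ratio (p ρ : ℝ) : ℝ := dslope (fun t => N.Γ (p + t)) 0 ρ

/-- The metric `dρ² + Γ(p + ρ)² dβ²`, `x = ρ e^{iβ}`, in normal coordinates: unit length in the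
radial direction `x`, factor `(Γ(p + ρ) / ρ)²` in the direction `i x`, and no mixed term. -/
def metric (p : ℝ) (x v w : ℂ) : ℝ :=
  N.ratio p ‖x‖ ^ 2 * inner ℝ v w
    + (1 - N.ratio p ‖x‖ ^ 2) / ‖x‖ ^ 2 * (inner ℝ x v * inner ℝ x w)

/-- The complex structure in normal coordinates: the linear map with `J ∂_s = Γ⁻¹ ∂_β` and
`J ∂_β = -Γ ∂_s`, where `∂_s = x / |x|`, `∂_β = i x` and `Γ = Γ(p + |x|)`. -/
def J (p : ℝ) (x v : ℂ) : ℂ :=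
  (N.ratio p ‖x‖ : ℂ) * (Complex.I * v)
    + (((N.ratio p ‖x‖)⁻¹ * ((1 - N.ratio p ‖x‖ ^ 2) / ‖x‖ ^ 2) * inner ℝ x v : ℝ) : ℂ)
      * (Complex.I * x)

/-- The inner product `⟨D_a x_a, v⟩` of the Levi-Civita covariant derivative of the velocity of
the curve `x` with a vector `v`, in normal coordinates:
`g(x'', v) + Γ_{ij,l} x'^i x'^j v^l` with the Christoffel symbols of the first kind
`Γ_{ij,l} = (∂_i g_{jl} + ∂_j g_{il} - ∂_l g_{ij}) / 2`. -/
def covAccel (p : ℝ) (x : ℝ → ℂ) (a : ℝ) (v : ℂ) : ℝ :=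
  N.metric p (x a) (deriv (deriv x) a) v
    + fderiv ℝ (fun y => N.metric p y (deriv x a) v) (x a) (deriv x a)
    - 1 / 2 * fderiv ℝ (fun y => N.metric p y (deriv x a) (deriv x a)) (x a) v

/-- The equation `D_a W_a + a⁻¹ W_a + a⁻² ∇G - μ ∇F + (c / a) J W_a = 0` at `a`, for a curve with
normal coordinate `x` about the pole `p`: the inner product of the left-hand side with every
tangent vector `v` vanishes, where `⟨∇G, v⟩ = dG(v)`. -/
def EquationAt (μ k b c p : ℝ) (x : ℝ → ℂ) (a : ℝ) : Prop :=
  ∀ v : ℂ,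
    N.covAccel p x a v
      + 1 / a * N.metric p (x a) (deriv x a) v
      + 1 / a ^ 2 * fderiv ℝ (fun y : ℂ => N.G k b (p + ‖y‖)) (x a) v
      - μ * fderiv ℝ (fun y : ℂ => N.F (p + ‖y‖)) (x a) v
      + c / a * N.metric p (x a) (N.J p (x a) (deriv x a)) v = 0

/-- `W` is a (`C²`) solution of
`D_a W_a + a⁻¹ W_a + a⁻² ∇G - μ ∇F + (c / a) J W_a = 0` on the open set `I`. -/
def IsSolutionOn (μ k b c : ℝ) (W : ℝ → N.Point) (I : Set ℝ) : Prop :=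
  ∀ a ∈ I, ∃ (p : ℝ) (x : ℝ → ℂ), N.Γ p = 0 ∧ ContDiffAt ℝ 2 x a ∧
    (∀ᶠ t in 𝓝 a, ENNReal.ofReal ‖x t‖ < N.radius ∧ W t = N.normalChart p (x t)) ∧
    N.EquationAt μ k b c p x a

/-- `(s, β)` are differentiable polar coordinates along the curve `W` on `I`. As the curve runs
through a pole, `s` may change sign (or exceed `s₀`). -/
def IsPolarLift (W : ℝ → N.Point) (s β : ℝ → ℝ) (I : Set ℝ) : Prop :=
  ∀ a ∈ I, DifferentiableAt ℝ s a ∧ DifferentiableAt ℝ β a ∧ W a = N.expO (s a) (β a)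

/-- The angular component `σ = ⟨W_a, J ∂_s⟩ = Γ(s) β_a` of the velocity
`W_a = s_a ∂_s + β_a ∂_β = s_a ∂_s + σ J ∂_s`. -/
def sigma (s β : ℝ → ℝ) (a : ℝ) : ℝ := N.Γ (s a) * deriv β a

/-- The length `|W_a| = (s_a² + σ²)^{1/2}` of the velocity. -/
def speed (s β : ℝ → ℝ) (a : ℝ) : ℝ := Real.sqrt (deriv s a ^ 2 + N.sigma s β a ^ 2)

end RevolutionSurface

end

/-! ### Taylor expansion of odd functions -/

noncomputable section

/-! Put m = √(-μ). Rotation invariance makes a Γ² β_a + cF constant, and the conditions at a = 0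
force the constant to vanish (`IsSolutionOn.momentum_eq`); this is the formula for σ, and it gives σ
= O(|s|/a). The limsup hypothesis eventually confines |s| to a disc on which Γ(s)/s lies between
positive constants, and the radial component of the equation becomes a damped pendulum s'' + s'/a +
m²Γ(s) = O(|s|/a²) (`IsSolutionOn.exists_pendulum`). The polar form of the equation degenerates when
the curve passes through O; there s'' is recovered from the energy, which is positive at all times
because Grönwall's inequality would otherwise force W ≡ O.

For the pendulum, the scaled energy a(s'²/2 + m²F) + s s'/2 has derivative m²(F - sΓ/2) up to small
errors, and F - sΓ/2 = O(s⁴) because Γ is odd. A rough power decay first makes the logarithmic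
derivative integrable; so the scaled energy stays between positive constants and (s, s') has size
exactly a^{-1/2} (`DampedPendulum.exists_decay`).

The complex amplitude ζ = √a (m s + i s') then satisfies ζ' = -imζ + a⁻¹(ζ̄/2 - iγ(Re ζ)³/(6m)) +
O(a⁻²) with γ = Γ'''(0). A near-identity change of variable removes every a⁻¹ term except the
resonant multiple of |ζ|²ζ (`exists_near_identity`), which only shifts the frequency. Hence |ζ|²
converges to some 2E at rate a⁻¹, and integrating the frequency shift γ|ζ|²/(16ma) produces the
logarithm in the phase (`exists_resonant_asymptotics`). Real and imaginary parts give s and s', and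
F/Γ = s/2 + O(s³) gives σ. -/

theorem iteratedDeriv_two_mul_eq_zero_of_odd {f : ℝ → ℝ} (hf : ∀ x, f (-x) = -f x) (n : ℕ) :
    iteratedDeriv (2 * n) f 0 = 0 := by
  have h1 := iteratedDeriv_comp_neg (2 * n) f 0
  have h2 : (fun x => f (-x)) = -f := by funext x; simp [hf]
  rw [h2, iteratedDeriv_neg] at h1
  simp at h1
  linarith

/-- An odd smooth function agrees with its cubic Taylor polynomial up to a quintic error. -/
theorem exists_abs_sub_cubic_le {f : ℝ → ℝ} (hf : ContDiff ℝ ∞ f)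
    (hodd : ∀ x, f (-x) = -f x) (R : ℝ) :
    ∃ C, 0 ≤ C ∧ ∀ x, |x| ≤ R →
      |f x - deriv f 0 * x - iteratedDeriv 3 f 0 / 6 * x ^ 3| ≤ C * |x| ^ 5 := by
  have hcont : Continuous (iteratedDeriv 5 f) := (contDiff_infty.1 hf 5).continuous_iteratedDeriv 5 le_rfl
  obtain ⟨C, hC⟩ := (isCompact_Icc (a := -R) (b := R)).exists_bound_of_continuousOn
    hcont.continuousOn
  refine ⟨max C 0, le_max_right _ _, fun x hx => ?_⟩
  rcases eq_or_ne x 0 with rfl | hx0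
  · have : f 0 = 0 := by have := hodd 0; simp at this; linarith
    simp [this]
  obtain ⟨y, hy, h⟩ := taylor_mean_remainder_lagrange_iteratedDeriv (n := 4) (f := f) (x₀ := 0)
    (x := x) hx0.symm (by exact_mod_cast (contDiff_infty.1 hf 5).contDiffOn)
  have hu : UniqueDiffOn ℝ (Set.uIcc 0 x) := uniqueDiffOn_uIcc hx0.symm
  have hi : ∀ n : ℕ, iteratedDerivWithin n f (Set.uIcc 0 x) 0 = iteratedDeriv n f 0 := by
    intro n
    exact iteratedDerivWithin_eq_iteratedDeriv hu (contDiff_infty.1 hf n).contDiffAt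
      Set.left_mem_uIcc
  -- The terms of degree 0, 2 and 4 vanish, so the degree-4 polynomial is the cubic one and the
  -- remainder has order five.
  have h0 := iteratedDeriv_two_mul_eq_zero_of_odd hodd 0
  have h2 := iteratedDeriv_two_mul_eq_zero_of_odd hodd 1
  have h4 := iteratedDeriv_two_mul_eq_zero_of_odd hodd 2
  simp only [taylor_within_apply, hi] at h
  norm_num [Finset.sum_range_succ, Nat.factorial] at h h0 h2 h4
  rw [h0, h2, h4] at h
  have hym : |y| ≤ R := by
    rcases lt_or_gt_of_ne hx0 with hneg | hpos
    · rw [Set.uIoo_of_gt hneg] at hy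
      rw [abs_of_neg hneg] at hx
      rw [abs_of_neg hy.2]; linarith [hy.1]
    · rw [Set.uIoo_of_lt hpos] at hy
      rw [abs_of_pos hpos] at hx
      rw [abs_of_pos hy.1]; linarith [hy.2]
  have hb := hC y (abs_le.1 hym)
  rw [Real.norm_eq_abs] at hb
  have h' : f x - deriv f 0 * x - iteratedDeriv 3 f 0 / 6 * x ^ 3
      = iteratedDeriv 5 f y * x ^ 5 / 120 := by linarith
  rw [h', abs_div, abs_mul, abs_pow]
  have hp : 0 ≤ |x| ^ 5 := by positivity
  have hC' : |iteratedDeriv 5 f y| ≤ max C 0 := hb.trans (le_max_left _ _)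
  have := mul_le_mul_of_nonneg_right hC' hp
  have : 0 ≤ |iteratedDeriv 5 f y| * |x| ^ 5 := by positivity
  rw [abs_of_pos (by norm_num : (0:ℝ) < 120)]
  linarith

/-! ### Elementary properties of `Γ` and `F` -/

namespace RevolutionSurface

variable (N : RevolutionSurface)

theorem differentiable_Γ : Differentiable ℝ N.Γ := N.smooth.differentiable (by simp)

theorem hasDerivAt_Γ (s : ℝ) : HasDerivAt N.Γ (deriv N.Γ s) s := (N.differentiable_Γ s).hasDerivAt

theorem continuous_Γ : Continuous N.Γ := N.smooth.continuous

theorem continuous_deriv_Γ : Continuous (deriv N.Γ) := N.smooth.continuous_deriv (by simp)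

@[simp] theorem Γ_zero : N.Γ 0 = 0 := by have := N.odd 0; simp at this; linarith

@[simp] theorem F_zero : N.F 0 = 0 := by simp [F]

theorem hasDerivAt_F (s : ℝ) : HasDerivAt N.F (N.Γ s) s :=
  intervalIntegral.integral_hasDerivAt_right (N.continuous_Γ.intervalIntegrable _ _)
    (N.continuous_Γ.stronglyMeasurableAtFilter _ _) N.continuous_Γ.continuousAt

theorem continuous_F : Continuous N.F :=
  continuous_iff_continuousAt.2 fun s => (N.hasDerivAt_F s).continuousAt

theorem deriv_Γ_zero : deriv N.Γ 0 = 1 := by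
  by_cases h : N.radius = ⊤
  · exact N.deriv_zero_of_top h
  · simpa using N.deriv_pole h 0

theorem F_neg (s : ℝ) : N.F (-s) = N.F s := by
  have h : ∀ s, HasDerivAt (fun s => N.F (-s) - N.F s) 0 s := by
    intro s
    have h1 := ((N.hasDerivAt_F (-s)).comp s (hasDerivAt_neg s)).sub (N.hasDerivAt_F s)
    refine h1.congr_deriv ?_
    rw [N.odd]; ring
  have := is_const_of_deriv_eq_zero (fun s => (h s).differentiableAt) (fun s => (h s).deriv) s 0
  simp at this
  linarith

theorem F_abs (s : ℝ) : N.F |s| = N.F s := by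
  rcases abs_choice s with h | h <;> rw [h]
  exact N.F_neg s

theorem Γ_abs_sq (s : ℝ) : N.Γ |s| ^ 2 = N.Γ s ^ 2 := by
  rcases abs_choice s with h | h <;> rw [h]
  rw [N.odd]; ring

theorem deriv_Γ_neg (s : ℝ) : deriv N.Γ (-s) = deriv N.Γ s := by
  have h : (fun x => N.Γ (-x)) = fun x => -N.Γ x := funext N.odd
  have h1 := deriv_comp_neg N.Γ s
  rw [h, deriv.fun_neg] at h1
  linarith

theorem deriv_Γ_abs (s : ℝ) : deriv N.Γ |s| = deriv N.Γ s := by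
  rcases abs_choice s with h | h <;> rw [h]
  exact N.deriv_Γ_neg s

section finite

variable {N}

theorem F_periodic (h : N.radius ≠ ⊤) : Function.Periodic N.F (2 * N.radius.toReal) := by
  intro s
  set T := 2 * N.radius.toReal
  have hd : ∀ s, HasDerivAt (fun s => N.F (s + T) - N.F s) 0 s := by
    intro s
    have h1 := ((N.hasDerivAt_F (s + T)).comp_add_const s T).sub (N.hasDerivAt_F s)
    refine h1.congr_deriv ?_
    rw [N.periodic h]; ring
  -- The constant is read off at -T/2, where evenness of `F` shows it to be zero.
  have := is_const_of_deriv_eq_zero (fun s => (hd s).differentiableAt) (fun s => (hd s).deriv) s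
    (-(T / 2))
  have h2 : N.F (-(T / 2) + T) = N.F (-(T / 2)) := by
    rw [N.F_neg]; congr 1; ring
  simp only [h2] at this
  linarith

theorem deriv_Γ_periodic (h : N.radius ≠ ⊤) : Function.Periodic (deriv N.Γ) (2 * N.radius.toReal) := by
  intro s
  have := deriv_comp_add_const N.Γ (2 * N.radius.toReal) s
  rw [← this]
  congr 1
  exact funext (N.periodic h)

end finite

/-- Every value of the radial coordinate can be moved to `[0, s₀]`. -/
theorem exists_reduced (s : ℝ) : ∃ u, 0 ≤ u ∧ ENNReal.ofReal u ≤ N.radius ∧ u ≤ |s| ∧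
    N.F u = N.F s ∧ N.Γ u ^ 2 = N.Γ s ^ 2 ∧ deriv N.Γ u = deriv N.Γ s := by
  by_cases h : N.radius = ⊤
  · exact ⟨|s|, abs_nonneg _, by simp [h], le_rfl, N.F_abs s, N.Γ_abs_sq s, N.deriv_Γ_abs s⟩
  · have hr : 0 < N.radius.toReal := ENNReal.toReal_pos N.radius_pos.ne' h
    set T := 2 * N.radius.toReal with hT
    have hT0 : 0 < T := by positivity
    -- Subtracting the nearest multiple of the period leaves a number in [-s₀, s₀]; that 0 is no
    -- nearer to s/T gives `u ≤ |s|`.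
    set n := round (s / T)
    have e1 : |s - n * T| = |s / T - n| * T := by
      rw [← abs_of_pos hT0, ← abs_mul, abs_of_pos hT0]; congr 1; field_simp
    refine ⟨|s - n * T|, abs_nonneg _, ?_, ?_, ?_, ?_, ?_⟩
    · rw [ENNReal.ofReal_le_iff_le_toReal h, e1]
      have := abs_sub_round (s / T)
      nlinarith
    · rw [e1]
      have := round_le (s / T) 0
      have h3 : |s| = |s / T - (0 : ℤ)| * T := by
        rw [← abs_of_pos hT0, ← abs_mul, abs_of_pos hT0]; congr 1; field_simp; simp
      rw [h3]
      exact mul_le_mul_of_nonneg_right this hT0.le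
    · rw [F_abs, (F_periodic h).sub_int_mul_eq]
    · rw [Γ_abs_sq, (N.periodic h).sub_int_mul_eq]
    · rw [deriv_Γ_abs, (deriv_Γ_periodic h).sub_int_mul_eq]

theorem Γ_ne_zero_of_lt {u : ℝ} (hu : 0 < u) (hu' : ENNReal.ofReal u < N.radius) : N.Γ u ≠ 0 := by
  by_cases h : N.radius = ⊤
  · rw [Ne, N.eq_zero_iff_of_top h]; exact hu.ne'
  · rw [Ne, N.eq_zero_iff h]
    rintro ⟨n, rfl⟩
    have hr : 0 < N.radius.toReal := ENNReal.toReal_pos N.radius_pos.ne' h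
    rw [ENNReal.ofReal_lt_iff_lt_toReal hu.le h] at hu'
    have h1 : (0 : ℝ) < n := by by_contra hn; push Not at hn; nlinarith
    have h2 : (n : ℝ) < 1 := by nlinarith
    have h3 : 0 < n := by exact_mod_cast h1
    have h4 : n < 1 := by exact_mod_cast h2
    omega

/-- Γ'(0) = 1 makes `Γ` positive just to the right of 0, and a later sign change would produce a
zero inside (0, s₀). -/
theorem Γ_pos {u : ℝ} (hu : 0 < u) (hu' : ENNReal.ofReal u < N.radius) : 0 < N.Γ u := by
  have hd := N.hasDerivAt_Γ 0
  rw [deriv_Γ_zero] at hd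
  have hev : ∀ᶠ t in 𝓝[>] (0 : ℝ), 0 < N.Γ t := by
    have h1 := hd.tendsto_slope_zero_right
    filter_upwards [h1.eventually (lt_mem_nhds (zero_lt_one)), self_mem_nhdsWithin] with t ht ht0
    simp only [zero_add, Γ_zero, sub_zero, smul_eq_mul] at ht
    have ht0' : (0 : ℝ) < t := ht0
    exact (pos_iff_pos_of_mul_pos ht).1 (inv_pos.2 ht0')
  obtain ⟨t, htΓ, ht⟩ := (hev.and (Ioo_mem_nhdsGT hu)).exists
  by_contra hneg
  push Not at hneg
  have hlt := lt_of_le_of_ne hneg (N.Γ_ne_zero_of_lt hu hu')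
  obtain ⟨y, hy, hy0⟩ := intermediate_value_Icc' ht.2.le N.continuous_Γ.continuousOn
    ⟨hlt.le, htΓ.le⟩
  exact N.Γ_ne_zero_of_lt (ht.1.trans_le hy.1)
    ((ENNReal.ofReal_le_ofReal hy.2).trans_lt hu') hy0

theorem F_lt_F {u v : ℝ} (hu : 0 ≤ u) (huv : u < v) (hv : ENNReal.ofReal v ≤ N.radius) :
    N.F u < N.F v := by
  have hmono : StrictMonoOn N.F (Set.Icc u v) := by
    apply strictMonoOn_of_deriv_pos (convex_Icc _ _) N.continuous_F.continuousOn
    intro x hx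
    rw [interior_Icc] at hx
    rw [(N.hasDerivAt_F x).deriv]
    exact N.Γ_pos (hu.trans_lt hx.1)
      (((ENNReal.ofReal_lt_ofReal_iff (hu.trans_lt huv)).2 hx.2).trans_le hv)
  exact hmono ⟨le_rfl, huv.le⟩ ⟨huv.le, le_rfl⟩ huv

theorem eq_of_F_eq {u v : ℝ} (hu : 0 ≤ u) (hv : 0 ≤ v) (hu' : ENNReal.ofReal u ≤ N.radius)
    (hv' : ENNReal.ofReal v ≤ N.radius) (h : N.F u = N.F v) : u = v := by
  rcases lt_trichotomy u v with h1 | h1 | h1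
  · exact absurd h (N.F_lt_F hu h1 hv').ne
  · exact h1
  · exact absurd h (N.F_lt_F hv h1 hu').ne'

theorem F_nonneg (s : ℝ) : 0 ≤ N.F s := by
  obtain ⟨u, hu, hu', -, hF, -⟩ := N.exists_reduced s
  rw [← hF]
  rcases hu.eq_or_lt with rfl | h
  · simp
  · simpa using (N.F_lt_F le_rfl h hu').le

/-- `F` is injective on [0, s₀], so its zeros are the representatives of O. This turns vanishing
energy into W = O. -/
theorem Γ_eq_zero_of_F_eq_zero {s : ℝ} (h : N.F s = 0) : N.Γ s = 0 := by
  obtain ⟨u, hu, hu', -, hF, hΓ, -⟩ := N.exists_reduced s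
  have : u = 0 := N.eq_of_F_eq hu le_rfl hu' (by simp) (by rw [hF, h, F_zero])
  subst this
  simpa using hΓ.symm

/-- The value of `F` determines the point up to rotation, hence `Γ'`. -/
theorem deriv_Γ_eq_of_F_eq {s t : ℝ} (h : N.F s = N.F t) : deriv N.Γ s = deriv N.Γ t := by
  obtain ⟨u, hu, hu', -, hF, -, hd⟩ := N.exists_reduced s
  obtain ⟨v, hv, hv', -, hF', -, hd'⟩ := N.exists_reduced t
  have : u = v := N.eq_of_F_eq hu hv hu' hv' (by rw [hF, hF', h])
  rw [← hd, ← hd', this]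

/-- On bounded sets `Γ²` is bounded by a multiple of `F`. -/
theorem exists_Γ_sq_le (S : ℝ) : ∃ M, 0 ≤ M ∧ ∀ s, |s| ≤ S → N.Γ s ^ 2 ≤ M * N.F s := by
  obtain ⟨C, hC⟩ := (isCompact_Icc (a := -S) (b := S)).exists_bound_of_continuousOn
    N.continuous_deriv_Γ.continuousOn
  refine ⟨2 * max C 0, by positivity, fun s hs => ?_⟩
  obtain ⟨u, hu, hu', hus, hF, hΓ, -⟩ := N.exists_reduced s
  rw [← hF, ← hΓ]
  -- With |Γ'| ≤ C, the function 2CF - Γ² has derivative 2Γ(C - Γ') ≥ 0 on [0, u] and vanishes at 0.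
  have hd : ∀ x, HasDerivAt (fun x => 2 * max C 0 * N.F x - N.Γ x ^ 2)
      (2 * N.Γ x * (max C 0 - deriv N.Γ x)) x := by
    intro x
    refine (((N.hasDerivAt_F x).const_mul (2 * max C 0)).sub
      ((N.hasDerivAt_Γ x).pow 2)).congr_deriv ?_
    norm_num; ring
  have hmono : MonotoneOn (fun x => 2 * max C 0 * N.F x - N.Γ x ^ 2) (Set.Icc 0 u) := by
    apply monotoneOn_of_deriv_nonneg (convex_Icc _ _)
      (fun x _ => (hd x).continuousAt.continuousWithinAt)
      (fun x _ => (hd x).differentiableAt.differentiableWithinAt)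
    intro x hx
    rw [interior_Icc] at hx
    rw [(hd x).deriv]
    have h1 := N.Γ_pos hx.1 (((ENNReal.ofReal_lt_ofReal_iff (hx.1.trans hx.2)).2 hx.2).trans_le hu')
    have h2 := hC x ⟨by linarith [hx.1, abs_nonneg s], by linarith [hx.2]⟩
    have h3 := le_abs_self (deriv N.Γ x)
    rw [Real.norm_eq_abs] at h2
    have h4 := le_max_left C 0
    have : 0 ≤ max C 0 - deriv N.Γ x := by linarith
    positivity
  have := hmono ⟨le_rfl, hu⟩ ⟨hu, le_rfl⟩ hu
  simp at this
  linarith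

/-! ### Behaviour of `Γ` at the poles -/

section pole

variable {N} {p : ℝ}

/-- Since p = n s₀, reflection in p is reflection in 0 followed by a translation by n periods 2s₀.
-/
theorem Γ_add_pole (hp : N.Γ p = 0) (t : ℝ) : N.Γ (p - t) = -N.Γ (p + t) := by
  by_cases h : N.radius = ⊤
  · rw [N.eq_zero_iff_of_top h] at hp
    subst hp
    simp [N.odd]
  · obtain ⟨n, rfl⟩ := (N.eq_zero_iff h p).1 hp
    rw [← (N.periodic h).sub_int_mul_eq n, ← N.odd]
    congr 1; ring

theorem deriv_pole_sq (hp : N.Γ p = 0) : deriv N.Γ p ^ 2 = 1 := by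
  by_cases h : N.radius = ⊤
  · rw [N.eq_zero_iff_of_top h] at hp
    subst hp
    simp [N.deriv_Γ_zero]
  · obtain ⟨n, rfl⟩ := (N.eq_zero_iff h p).1 hp
    rw [N.deriv_pole h]
    rcases Int.even_or_odd n with hn | hn
    · simp [hn.neg_one_zpow]
    · simp [hn.neg_one_zpow]

theorem Γ_pole_add_ne_zero (hp : N.Γ p = 0) {ρ : ℝ} (h0 : 0 < ρ) (h1 : ENNReal.ofReal ρ < N.radius) :
    N.Γ (p + ρ) ≠ 0 := by
  intro h2
  by_cases h : N.radius = ⊤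
  · rw [N.eq_zero_iff_of_top h] at hp h2
    linarith
  · obtain ⟨n, rfl⟩ := (N.eq_zero_iff h p).1 hp
    obtain ⟨l, hl⟩ := (N.eq_zero_iff h _).1 h2
    refine N.Γ_ne_zero_of_lt h0 h1 ((N.eq_zero_iff h _).2 ⟨l - n, ?_⟩)
    push_cast
    linarith

theorem hasDerivAt_Γ_pole : HasDerivAt (fun t => N.Γ (p + t)) (deriv N.Γ p) 0 := by
  have := (N.hasDerivAt_Γ (p + 0)).comp_const_add p 0
  simpa using this

/-- At a pole `Γ` is linear up to `o(ρ²)`. -/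
theorem Γ_pole_isLittleO (hp : N.Γ p = 0) :
    (fun t => N.Γ (p + t) - deriv N.Γ p * t) =o[𝓝 0] fun t => t ^ 2 := by
  set g := fun t => N.Γ (p + t) with hg
  have hsm : ContDiff ℝ ∞ g := N.smooth.comp (contDiff_const.add contDiff_id)
  have h := taylor_isLittleO_univ (f := g) (x₀ := 0) (n := 2)
    (by exact_mod_cast contDiff_infty.1 hsm 2)
  have h2 := iteratedDeriv_two_mul_eq_zero_of_odd (f := g) (fun t => by
    simp only [hg]; rw [← Γ_add_pole hp]; congr 1) 1
  have h1 : deriv g 0 = deriv N.Γ p := hasDerivAt_Γ_pole.deriv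
  have h0 : g 0 = 0 := by simp [hg, hp]
  simp only [taylor_within_apply, iteratedDerivWithin_univ] at h
  norm_num [Finset.sum_range_succ, Nat.factorial] at h h2
  rw [h2, h1, h0] at h
  refine h.congr_left fun t => ?_
  ring

end pole

end RevolutionSurface

/-! ### Calculus of the metric in normal coordinates -/

theorem Complex.real_inner_eq (v w : ℂ) : inner ℝ v w = v.re * w.re + v.im * w.im := by
  rw [Complex.inner]; simp; ring

theorem Complex.sq_norm_eq_re_im (v : ℂ) : ‖v‖ ^ 2 = v.re ^ 2 + v.im ^ 2 := by
  rw [Complex.sq_norm, Complex.normSq_apply]; ring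

theorem hasDerivAt_norm_complex {x : ℝ → ℂ} {x' : ℂ} {a : ℝ} (hx : HasDerivAt x x' a)
    (h0 : x a ≠ 0) : HasDerivAt (fun t => ‖x t‖) (inner ℝ (x a) x' / ‖x a‖) a := by
  have h1 := hx.norm_sq.sqrt (by positivity)
  simp only [Real.sqrt_sq (norm_nonneg _)] at h1
  refine h1.congr_deriv ?_
  field_simp

theorem HasDerivAt.complex_re {x : ℝ → ℂ} {x' : ℂ} {a : ℝ} (hx : HasDerivAt x x' a) :
    HasDerivAt (fun t => (x t).re) x'.re a :=
  (Complex.reCLM.hasFDerivAt (x := x a)).comp_hasDerivAt a hx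

theorem HasDerivAt.complex_im {x : ℝ → ℂ} {x' : ℂ} {a : ℝ} (hx : HasDerivAt x x' a) :
    HasDerivAt (fun t => (x t).im) x'.im a :=
  (Complex.imCLM.hasFDerivAt (x := x a)).comp_hasDerivAt a hx

namespace RevolutionSurface

variable {N : RevolutionSurface} {p : ℝ}

theorem mul_ratio (hp : N.Γ p = 0) (ρ : ℝ) : ρ * N.ratio p ρ = N.Γ (p + ρ) := by
  have := sub_smul_dslope (fun t => N.Γ (p + t)) 0 ρ
  simpa [hp, ratio] using this

theorem ratio_zero : N.ratio p 0 = deriv N.Γ p := by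
  rw [ratio, dslope_same]; exact hasDerivAt_Γ_pole.deriv

theorem ratio_eq_div (hp : N.Γ p = 0) {ρ : ℝ} (h : ρ ≠ 0) : N.ratio p ρ = N.Γ (p + ρ) / ρ := by
  rw [← mul_ratio hp]; field_simp

theorem ratio_ne_zero (hp : N.Γ p = 0) {ρ : ℝ} (h0 : 0 ≤ ρ) (h : ENNReal.ofReal ρ < N.radius) :
    N.ratio p ρ ≠ 0 := by
  rcases h0.eq_or_lt with rfl | h1
  · rw [ratio_zero]
    have := deriv_pole_sq hp
    intro h2; simp [h2] at this
  · rw [ratio_eq_div hp h1.ne']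
    exact div_ne_zero (Γ_pole_add_ne_zero hp h1 h) h1.ne'

theorem hasDerivAt_ratio (hp : N.Γ p = 0) {ρ : ℝ} (h : ρ ≠ 0) :
    HasDerivAt (N.ratio p) ((deriv N.Γ (p + ρ) - N.ratio p ρ) / ρ) ρ := by
  have h1 := ((N.hasDerivAt_Γ (p + ρ)).comp_const_add p ρ).div (hasDerivAt_id ρ) h
  have h2 : N.ratio p =ᶠ[𝓝 ρ] (fun t => N.Γ (p + t)) / id := by
    filter_upwards [isOpen_ne.mem_nhds h] with t ht
    exact ratio_eq_div hp ht
  refine (h1.congr_of_eventuallyEq h2).congr_deriv ?_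
  rw [← mul_ratio hp]
  simp only [id]
  field_simp

/-- An error o(ρ), rather than O(ρ), makes `ratio p ‖y‖` differentiable at y = 0, where the norm
itself is not. -/
theorem ratio_sub_isLittleO (hp : N.Γ p = 0) :
    (fun t => N.ratio p t - deriv N.Γ p) =o[𝓝 0] fun t => t := by
  have h := Γ_pole_isLittleO hp
  rw [isLittleO_iff] at h ⊢
  intro c hc
  filter_upwards [h hc] with t ht
  rcases eq_or_ne t 0 with rfl | h0
  · simp [ratio_zero]
  · rw [← mul_ratio hp, show t * N.ratio p t - deriv N.Γ p * t = t * (N.ratio p t - deriv N.Γ p)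
      by ring, norm_mul, norm_pow, pow_two] at ht
    have : 0 < ‖t‖ := norm_pos_iff.2 h0
    have h2 : ‖t‖ * ‖N.ratio p t - deriv N.Γ p‖ ≤ ‖t‖ * (c * ‖t‖) := by linarith
    exact le_of_mul_le_mul_left h2 this

theorem ratio_norm_sub_isLittleO (hp : N.Γ p = 0) :
    (fun y : ℂ => N.ratio p ‖y‖ - deriv N.Γ p) =o[𝓝 0] fun y => y := by
  have h : Tendsto (fun y : ℂ => ‖y‖) (𝓝 0) (𝓝 0) := by simpa using tendsto_norm_zero (E := ℂ)
  exact ((ratio_sub_isLittleO hp).comp_tendsto h).norm_right.trans_isBigO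
    (isBigO_of_le _ fun y => by simp)

theorem hasFDerivAt_of_sub_isLittleO {f : ℂ → ℝ} {c : ℝ} (hf : f 0 = c)
    (h : (fun y => f y - c) =o[𝓝 0] fun y : ℂ => y) : HasFDerivAt f (0 : ℂ →L[ℝ] ℝ) 0 := by
  rw [hasFDerivAt_iff_isLittleO]
  simpa [hf] using h

theorem differentiableAt_norm_complex {y : ℂ} (h : y ≠ 0) :
    DifferentiableAt ℝ (fun y : ℂ => ‖y‖) y := differentiableAt_id.norm ℝ h

theorem differentiableAt_ratio_norm (hp : N.Γ p = 0) (y : ℂ) :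
    DifferentiableAt ℝ (fun y : ℂ => N.ratio p ‖y‖) y := by
  rcases eq_or_ne y 0 with rfl | h
  · exact (hasFDerivAt_of_sub_isLittleO (by simp [ratio_zero])
      (ratio_norm_sub_isLittleO hp)).differentiableAt
  · exact ((hasDerivAt_ratio hp (norm_ne_zero_iff.2 h)).differentiableAt).comp y
      (differentiableAt_norm_complex h)

/-- Only y = 0 is delicate. There the two inner products contribute |y|² and cancel the denominator,
so the second term of the metric is bounded by a multiple of |1 - ratio²| = o(|y|). -/
theorem differentiableAt_metric (hp : N.Γ p = 0) (v w y : ℂ) :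
    DifferentiableAt ℝ (fun y : ℂ => N.metric p y v w) y := by
  have hr := differentiableAt_ratio_norm hp y
  refine ((hr.pow 2).mul_const _).add ?_
  rcases eq_or_ne y 0 with rfl | h
  · refine (hasFDerivAt_of_sub_isLittleO (c := 0) (by simp) ?_).differentiableAt
    have h1 : (fun y : ℂ => 1 - N.ratio p ‖y‖ ^ 2) =o[𝓝 0] fun y => y := by
      have hc : (fun y : ℂ => -(N.ratio p ‖y‖ + deriv N.Γ p)) =O[𝓝 0] fun _ => (1 : ℝ) :=
        (((differentiableAt_ratio_norm hp 0).continuousAt.add continuousAt_const).neg).isBigO_one ℝ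
      have := hc.mul_isLittleO (ratio_norm_sub_isLittleO hp).norm_right
      simp only [one_mul] at this
      refine this.norm_right.congr_left (fun y => ?_) |>.trans_isBigO (isBigO_of_le _ fun y => ?_)
      · rw [← deriv_pole_sq hp]; ring
      · simp
    refine IsBigO.trans_isLittleO (IsBigO.of_bound (‖v‖ * ‖w‖) (.of_forall fun y => ?_)) h1
    rcases eq_or_ne y 0 with rfl | hy
    · simp; positivity
    · have a1 := abs_real_inner_le_norm y v
      have a2 := abs_real_inner_le_norm y w
      have hy' : 0 < ‖y‖ := norm_pos_iff.2 hy
      rw [sub_zero, norm_mul, norm_mul, norm_div, Real.norm_eq_abs (inner ℝ y v),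
        Real.norm_eq_abs (inner ℝ y w), norm_pow, norm_norm, div_mul_eq_mul_div,
        div_le_iff₀ (by positivity)]
      have := mul_le_mul a1 a2 (abs_nonneg _) (by positivity)
      calc _ ≤ ‖1 - N.ratio p ‖y‖ ^ 2‖ * (‖y‖ * ‖v‖ * (‖y‖ * ‖w‖)) := by gcongr
        _ = _ := by ring
  · have hn := differentiableAt_norm_complex h
    have hn2 : ‖y‖ ^ 2 ≠ 0 := by simpa using h
    have hq : DifferentiableAt ℝ (fun y : ℂ => (1 - N.ratio p ‖y‖ ^ 2) / ‖y‖ ^ 2) y := by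
      simp only [div_eq_mul_inv]
      exact ((differentiableAt_const (1 : ℝ)).sub (hr.pow 2)).mul ((hn.pow 2).fun_inv hn2)
    exact hq.mul
      ((differentiableAt_id.inner ℝ (differentiableAt_const _)).mul
        (differentiableAt_id.inner ℝ (differentiableAt_const _)))

theorem metric_expand (y v w : ℂ) : N.metric p y v w =
    v.re * w.re * N.metric p y 1 1 + (v.re * w.im + v.im * w.re) * N.metric p y 1 Complex.I
      + v.im * w.im * N.metric p y Complex.I Complex.I := by
  simp only [metric, Complex.real_inner_eq, Complex.one_re, Complex.one_im, Complex.I_re,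
    Complex.I_im]
  ring

/-- Product rule for a bilinear form with varying coefficients, obtained by expanding in the basis
1, i. -/
theorem hasDerivAt_metric (hp : N.Γ p = 0) {x V U : ℝ → ℂ} {x' V' U' : ℂ} {a : ℝ}
    (hx : HasDerivAt x x' a) (hV : HasDerivAt V V' a) (hU : HasDerivAt U U' a) :
    HasDerivAt (fun t => N.metric p (x t) (V t) (U t))
      (fderiv ℝ (fun y => N.metric p y (V a) (U a)) (x a) x' + N.metric p (x a) V' (U a)
        + N.metric p (x a) (V a) U') a := by
  have hg : ∀ v w, HasDerivAt (fun t => N.metric p (x t) v w)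
      (fderiv ℝ (fun y => N.metric p y v w) (x a) x') a := fun v w =>
    (differentiableAt_metric hp v w (x a)).hasFDerivAt.comp_hasDerivAt a hx
  have h1 := hg (V a) (U a)
  have hVr := hV.complex_re
  have hVi := hV.complex_im
  have hUr := hU.complex_re
  have hUi := hU.complex_im
  have h2 := (((hVr.mul hUr).mul (hg 1 1)).add
    (((hVr.mul hUi).add (hVi.mul hUr)).mul (hg 1 Complex.I))).add
    ((hVi.mul hUi).mul (hg Complex.I Complex.I))
  -- The same expansion with the two vectors frozen expresses the derivative of the metric through
  -- those of its three coefficients.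
  have h3 := (((hg 1 1).const_mul ((V a).re * (U a).re)).add ((hg 1 Complex.I).const_mul
    ((V a).re * (U a).im + (V a).im * (U a).re))).add
    ((hg Complex.I Complex.I).const_mul ((V a).im * (U a).im))
  have h4 := h1.unique (h3.congr_of_eventuallyEq (.of_forall fun t => metric_expand _ _ _))
  refine (h2.congr_of_eventuallyEq (.of_forall fun t => metric_expand _ _ _)).congr_deriv ?_
  rw [h4, metric_expand (x a) V' (U a), metric_expand (x a) (V a) U']
  simp only [Pi.mul_apply, Pi.add_apply]
  ring

theorem metric_comm (y v w : ℂ) : N.metric p y v w = N.metric p y w v := by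
  simp only [metric, Complex.real_inner_eq]; ring

/-- The radial direction is a unit direction and orthogonal to the rotations. -/
theorem metric_radial (y v : ℂ) : N.metric p y v y = inner ℝ v y := by
  rcases eq_or_ne y 0 with rfl | h
  · simp [metric]
  · have : ‖y‖ ≠ 0 := norm_ne_zero_iff.2 h
    rw [metric, real_inner_self_eq_norm_sq, real_inner_comm]
    field_simp; ring

theorem metric_angular (y v : ℂ) :
    N.metric p y v (Complex.I * y) = N.ratio p ‖y‖ ^ 2 * (y.re * v.im - y.im * v.re) := by
  simp only [metric, Complex.real_inner_eq, Complex.mul_re, Complex.mul_im, Complex.I_re,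
    Complex.I_im]
  ring

theorem metric_self (y v : ℂ) (h : y ≠ 0) : N.metric p y v v =
    (inner ℝ y v / ‖y‖) ^ 2
      + (N.ratio p ‖y‖ * ((y.re * v.im - y.im * v.re) / ‖y‖)) ^ 2 := by
  have h0 : ‖y‖ ^ 2 ≠ 0 := by simpa using h
  rw [mul_pow, div_pow, div_pow]
  simp only [metric, Complex.real_inner_eq]
  field_simp
  rw [Complex.sq_norm_eq_re_im]
  ring

/-- `J` is skew, so the term with c does no work and is absent from the energy balance. -/
theorem metric_J_self (y v : ℂ) : N.metric p y (N.J p y v) v = 0 := by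
  -- This holds even when the ratio is 0, since the inverse of 0 is 0.
  have hr : N.ratio p ‖y‖ ^ 2 * (N.ratio p ‖y‖)⁻¹ = N.ratio p ‖y‖ := by
    rcases eq_or_ne (N.ratio p ‖y‖) 0 with h | h
    · simp [h]
    · field_simp
  simp only [metric, J, Complex.real_inner_eq, Complex.mul_re, Complex.mul_im, Complex.I_re,
    Complex.I_im, Complex.add_re, Complex.add_im, Complex.ofReal_re, Complex.ofReal_im]
  linear_combination ((1 - N.ratio p ‖y‖ ^ 2) / ‖y‖ ^ 2) * (y.re * v.re + y.im * v.im) *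
    (y.re * v.im - y.im * v.re) * hr

theorem metric_J_radial (y v : ℂ) : N.metric p y (N.J p y v) y =
    -(N.ratio p ‖y‖ * (y.re * v.im - y.im * v.re)) := by
  rw [metric_radial]
  simp only [J, Complex.real_inner_eq, Complex.mul_re, Complex.mul_im, Complex.I_re,
    Complex.I_im, Complex.add_re, Complex.add_im, Complex.ofReal_re, Complex.ofReal_im]
  ring

theorem metric_J_angular (y v : ℂ) (h : N.ratio p ‖y‖ ≠ 0) :
    N.metric p y (N.J p y v) (Complex.I * y) = N.ratio p ‖y‖ * inner ℝ y v := by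
  rw [metric_angular]
  rcases eq_or_ne y 0 with rfl | h0
  · simp
  have h0 : ‖y‖ ^ 2 ≠ 0 := by simpa using h0
  simp only [J, Complex.real_inner_eq, Complex.mul_re, Complex.mul_im, Complex.I_re,
    Complex.I_im, Complex.add_re, Complex.add_im, Complex.ofReal_re, Complex.ofReal_im]
  field_simp
  rw [Complex.sq_norm_eq_re_im]
  ring

theorem hasDerivAt_rotation (x : ℂ) :
    HasDerivAt (fun t : ℝ => Complex.exp (t * Complex.I) * x) (Complex.I * x) 0 := by
  have h1 : HasDerivAt (fun t : ℝ => (t : ℂ)) 1 0 := Complex.ofRealCLM.hasDerivAt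
  have h := ((h1.mul_const Complex.I).cexp).mul_const x
  simpa using h

theorem norm_rotation (t : ℝ) (x : ℂ) : ‖Complex.exp (t * Complex.I) * x‖ = ‖x‖ := by
  rw [norm_mul, Complex.norm_exp_ofReal_mul_I, one_mul]

theorem inner_rotation (t : ℝ) (v w : ℂ) :
    inner ℝ (Complex.exp (t * Complex.I) * v) (Complex.exp (t * Complex.I) * w) = inner ℝ v w := by
  have h := Complex.norm_exp_ofReal_mul_I t
  have h2 := Complex.sq_norm_eq_re_im (Complex.exp (t * Complex.I))
  rw [h] at h2
  simp only [Complex.real_inner_eq, Complex.mul_re, Complex.mul_im]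
  linear_combination (-(v.re * w.re + v.im * w.im)) * h2

/-- Rotations are isometries, infinitesimally. -/
theorem fderiv_metric_angular (hp : N.Γ p = 0) (x w : ℂ) :
    fderiv ℝ (fun y => N.metric p y w w) x (Complex.I * x)
      = -2 * N.metric p x w (Complex.I * w) := by
  have h := hasDerivAt_metric hp (hasDerivAt_rotation x) (hasDerivAt_rotation w)
    (hasDerivAt_rotation w)
  have hc : (fun t : ℝ => N.metric p (Complex.exp (t * Complex.I) * x)
      (Complex.exp (t * Complex.I) * w) (Complex.exp (t * Complex.I) * w))
      = fun _ => N.metric p x w w := by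
    funext t
    simp only [metric, norm_rotation, inner_rotation]
  rw [hc] at h
  have := h.unique (hasDerivAt_const _ _)
  simp only [Complex.ofReal_zero, zero_mul, Complex.exp_zero, one_mul] at this
  rw [metric_comm x (Complex.I * w)] at this
  linarith

/-- Differentiation along the dilation (1 + t)x with w fixed: the radial and angular components of w
are constant, and only the factor ratio² of the angular one varies. -/
theorem fderiv_metric_radial (hp : N.Γ p = 0) (x w : ℂ) (h : x ≠ 0) :
    fderiv ℝ (fun y => N.metric p y w w) x x =
      2 * N.ratio p ‖x‖ * (deriv N.Γ (p + ‖x‖) - N.ratio p ‖x‖) *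
        ((x.re * w.im - x.im * w.re) / ‖x‖) ^ 2 := by
  have hx : HasDerivAt (fun t : ℝ => ((1 + t : ℝ) : ℂ) * x) x 0 := by
    have h1 : HasDerivAt (fun t : ℝ => ((1 + t : ℝ) : ℂ)) 1 0 := by
      have : HasDerivAt (fun t : ℝ => 1 + t) 1 0 := (hasDerivAt_id (0 : ℝ)).const_add 1
      simpa using this.ofReal_comp
    simpa using h1.mul_const x
  have h1 := hasDerivAt_metric hp hx (hasDerivAt_const 0 w) (hasDerivAt_const 0 w)
  have hn : ‖x‖ ≠ 0 := norm_ne_zero_iff.2 h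
  have hρ : HasDerivAt (fun t : ℝ => ‖x‖ * (1 + t)) ‖x‖ 0 := by
    simpa using ((hasDerivAt_id (0 : ℝ)).const_add 1).const_mul ‖x‖
  have hr : HasDerivAt (fun t : ℝ => N.ratio p (‖x‖ * (1 + t)))
      ((deriv N.Γ (p + ‖x‖) - N.ratio p ‖x‖) / ‖x‖ * ‖x‖) 0 :=
    HasDerivAt.comp (h₂ := N.ratio p) 0 (by simpa using hasDerivAt_ratio hp hn) hρ
  have h2 := ((hr.pow 2).mul_const (((x.re * w.im - x.im * w.re) / ‖x‖) ^ 2)).const_add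
    ((inner ℝ x w / ‖x‖) ^ 2)
  have hev : (fun t : ℝ => N.metric p (((1 + t : ℝ) : ℂ) * x) w w) =ᶠ[𝓝 0]
      fun t => (inner ℝ x w / ‖x‖) ^ 2 + (N.ratio p (‖x‖ * (1 + t))) ^ 2 *
        ((x.re * w.im - x.im * w.re) / ‖x‖) ^ 2 := by
    filter_upwards [lt_mem_nhds (show (-1 : ℝ) < 0 by norm_num)] with t ht
    have h1t : 0 < 1 + t := by linarith
    have hne : ((1 + t : ℝ) : ℂ) * x ≠ 0 :=
      mul_ne_zero (by exact_mod_cast h1t.ne') h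
    have hnorm : ‖((1 + t : ℝ) : ℂ) * x‖ = ‖x‖ * (1 + t) := by
      rw [norm_mul, Complex.norm_real, Real.norm_of_nonneg h1t.le, mul_comm]
    rw [metric_self _ _ hne, hnorm]
    simp only [Complex.real_inner_eq, Complex.mul_re, Complex.mul_im, Complex.ofReal_re,
      Complex.ofReal_im]
    field_simp
    ring
  have := h1.unique (h2.congr_of_eventuallyEq hev)
  have hz : N.metric p x 0 w = 0 ∧ N.metric p x w 0 = 0 := by simp [metric]
  simp only [add_zero, Complex.ofReal_one, one_mul, hz.1, hz.2] at this
  rw [this, mul_one]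
  push_cast
  field_simp

/-- Here `f'` is the derivative of f divided by `Γ`. Away from the pole Γ = ρ · ratio cancels the
singular 1/ρ in the gradient of the norm; at the pole Γ = 0 makes the derivative vanish. It is
applied to `F` and `G`. -/
theorem hasFDerivAt_radial {f : ℝ → ℝ} {f' : ℝ → ℝ} (hf : ∀ t, HasDerivAt f (N.Γ t * f' t) t)
    (hp : N.Γ p = 0) (x : ℂ) :
    HasFDerivAt (fun y : ℂ => f (p + ‖y‖)) ((N.ratio p ‖x‖ * f' (p + ‖x‖)) • innerSL ℝ x) x := by
  rcases eq_or_ne x 0 with rfl | h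
  · have h1 : HasDerivAt f 0 p := by simpa [hp] using hf p
    have h2 := h1.isLittleO
    have ht : Tendsto (fun y : ℂ => p + ‖y‖) (𝓝 0) (𝓝 p) := by
      have : Continuous fun y : ℂ => p + ‖y‖ := by fun_prop
      simpa using this.tendsto 0
    have h3 := h2.comp_tendsto ht
    have h4 := hasFDerivAt_of_sub_isLittleO (f := fun y : ℂ => f (p + ‖y‖)) (c := f p) (by simp) (by
      refine (h3.congr_left fun y => by simp).trans_isBigO (isBigO_of_le _ fun y => by simp))
    simpa using h4
  · have hn : ‖x‖ ≠ 0 := norm_ne_zero_iff.2 h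
    have h1 : HasFDerivAt (fun y : ℂ => ‖y‖) (‖x‖⁻¹ • innerSL ℝ x) x := by
      have := (hasStrictFDerivAt_norm_sq x).hasFDerivAt.sqrt (by simpa using h)
      simp only [Real.sqrt_sq (norm_nonneg _)] at this
      refine this.congr_fderiv ?_
      ext v
      simp
      field_simp
    have h2 := (hf (p + ‖x‖)).comp_hasFDerivAt x (h1.const_add p)
    refine h2.congr_fderiv ?_
    rw [← mul_ratio hp, smul_smul]
    congr 1
    field_simp

end RevolutionSurface

/-! ### Comparison of polar and normal coordinates; conservation laws -/

namespace RevolutionSurface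

variable {N : RevolutionSurface} {p : ℝ}

/-- The lift s need not equal p + ‖x‖, as it may be negative or exceed s₀. All comparisons therefore
go through `F(s)` and Γ e^{iβ}, which depend on the point alone. -/
theorem chart_eq (hp : N.Γ p = 0) {s β : ℝ} {x : ℂ} (h : N.expO s β = N.normalChart p x) :
    N.F s = N.F (p + ‖x‖) ∧
      (N.Γ s : ℂ) * Complex.exp (β * Complex.I) = (N.ratio p ‖x‖ : ℂ) * x := by
  have h1 := congrArg Subtype.val h
  simp only [normalChart, expO, polar, Prod.mk.injEq] at h1
  refine ⟨h1.1, h1.2.trans ?_⟩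
  conv_rhs => rw [← Complex.norm_mul_exp_arg_mul_I x]
  rw [← mul_ratio hp]
  simp only [norm_mul, Complex.norm_real, norm_norm, Complex.norm_exp_ofReal_mul_I, mul_one]
  push_cast
  ring

theorem chart_Γ_sq {s β : ℝ} {x : ℂ}
    (h : (N.Γ s : ℂ) * Complex.exp (β * Complex.I) = (N.ratio p ‖x‖ : ℂ) * x) :
    N.Γ s ^ 2 = N.ratio p ‖x‖ ^ 2 * ‖x‖ ^ 2 := by
  have := congrArg (fun z : ℂ => ‖z‖ ^ 2) h
  simpa [mul_pow, Complex.norm_exp_ofReal_mul_I] using this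

section

variable {x : ℝ → ℂ} {s β : ℝ → ℝ} {a : ℝ}

/-- Both sides are the derivative of `F` along the curve, which makes sense at the poles too. -/
theorem Γ_mul_deriv_eq (hp : N.Γ p = 0) (hx : DifferentiableAt ℝ x a)
    (hs : DifferentiableAt ℝ s a)
    (hev : ∀ᶠ t in 𝓝 a, N.expO (s t) (β t) = N.normalChart p (x t)) :
    N.Γ (s a) * deriv s a = N.ratio p ‖x a‖ * inner ℝ (x a) (deriv x a) := by
  have h1 := (N.hasDerivAt_F (s a)).comp a hs.hasDerivAt
  have h2 := (hasFDerivAt_radial (N := N) (f := N.F) (f' := fun _ => 1)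
    (fun t => by simpa using N.hasDerivAt_F t) hp (x a)).comp_hasDerivAt a hx.hasDerivAt
  have h3 : N.F ∘ s =ᶠ[𝓝 a] (fun y : ℂ => N.F (p + ‖y‖)) ∘ x := by
    filter_upwards [hev] with t ht using (chart_eq hp ht).1
  have := h1.unique (h2.congr_of_eventuallyEq h3)
  simpa using this

theorem hasDerivAt_ratio_norm (hp : N.Γ p = 0) (hx : DifferentiableAt ℝ x a) :
    ∃ r', HasDerivAt (fun t => N.ratio p ‖x t‖) r' a :=
  ⟨_, ((differentiableAt_ratio_norm hp (x a)).hasFDerivAt.comp_hasDerivAt a hx.hasDerivAt)⟩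

/-- The velocity in the two descriptions `Γ(s) e^{iβ}` and `ratio · x`. -/
theorem exists_velocity_eq (hp : N.Γ p = 0) (hx : DifferentiableAt ℝ x a)
    (hs : DifferentiableAt ℝ s a) (hβ : DifferentiableAt ℝ β a)
    (hev : ∀ᶠ t in 𝓝 a, N.expO (s t) (β t) = N.normalChart p (x t)) :
    ∃ r' : ℝ, ((deriv N.Γ (s a) * deriv s a : ℝ) : ℂ) * Complex.exp (β a * Complex.I)
      + (N.Γ (s a) * deriv β a : ℝ) * (Complex.I * Complex.exp (β a * Complex.I))
      = (r' : ℂ) * x a + (N.ratio p ‖x a‖ : ℂ) * deriv x a := by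
  obtain ⟨r', hr'⟩ := hasDerivAt_ratio_norm (N := N) hp hx
  have h1 := ((N.hasDerivAt_Γ (s a)).comp a hs.hasDerivAt).ofReal_comp.mul
    ((hβ.hasDerivAt.ofReal_comp.mul_const Complex.I).cexp)
  have h2 := hr'.ofReal_comp.mul hx.hasDerivAt
  have h3 : ((fun y => (((N.Γ ∘ s) y : ℝ) : ℂ)) * fun y => Complex.exp ((β y : ℂ) * Complex.I))
      =ᶠ[𝓝 a] (fun y => ((N.ratio p ‖x y‖ : ℝ) : ℂ)) * x := by
    filter_upwards [hev] with t ht using (chart_eq hp ht).2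
  refine ⟨r', ?_⟩
  rw [← h1.unique (h2.congr_of_eventuallyEq h3)]
  push_cast
  simp only [Function.comp_apply]
  ring

/-- This is the cross product of Γ e^{iβ} = ratio · x with its derivative; the derivative of the
ratio multiplies x and drops out. -/
theorem Γ_sq_mul_deriv_eq (hp : N.Γ p = 0) (hx : DifferentiableAt ℝ x a)
    (hs : DifferentiableAt ℝ s a) (hβ : DifferentiableAt ℝ β a)
    (hev : ∀ᶠ t in 𝓝 a, N.expO (s t) (β t) = N.normalChart p (x t)) :
    N.Γ (s a) ^ 2 * deriv β a = N.metric p (x a) (deriv x a) (Complex.I * x a) := by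
  obtain ⟨r', hr'⟩ := exists_velocity_eq hp hx hs hβ hev
  have hz := (chart_eq hp hev.self_of_nhds).2
  have hE := Complex.norm_exp_ofReal_mul_I (β a)
  have hE2 := Complex.sq_norm_eq_re_im (Complex.exp (β a * Complex.I))
  rw [hE] at hE2
  set E := Complex.exp (β a * Complex.I)
  have e1 := congrArg Complex.re hr'
  have e2 := congrArg Complex.im hr'
  have e3 := congrArg Complex.re hz
  have e4 := congrArg Complex.im hz
  simp only [Complex.mul_re, Complex.mul_im, Complex.I_re,
    Complex.I_im, Complex.add_re, Complex.add_im, Complex.ofReal_re, Complex.ofReal_im] at e1 e2 e3 e4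
  rw [metric_angular]
  simp only [zero_mul, sub_zero, add_zero, zero_sub, one_mul, zero_add] at e1 e2 e3 e4
  set D := deriv N.Γ (s a) * deriv s a
  set B := N.Γ (s a) * deriv β a
  have key : (N.Γ (s a) * E.re) * (D * E.im + B * E.re) - (N.Γ (s a) * E.im) *
      (D * E.re + B * -E.im) = N.Γ (s a) * B := by
    linear_combination (-(N.Γ (s a) * B)) * hE2
  have : N.Γ (s a) * B = N.Γ (s a) ^ 2 * deriv β a := by ring
  rw [← this, ← key, e1, e2, e3, e4]
  ring

/-- Away from the pole the radial and angular identities combine. At the pole both position terms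
vanish and the velocity identity reduces to Γ'(s) s' e^{iβ} = Γ'(p) x', where both factors Γ' are
±1. -/
theorem speed_sq_eq (hp : N.Γ p = 0) (hx : DifferentiableAt ℝ x a)
    (hs : DifferentiableAt ℝ s a) (hβ : DifferentiableAt ℝ β a)
    (hr : ENNReal.ofReal ‖x a‖ < N.radius)
    (hev : ∀ᶠ t in 𝓝 a, N.expO (s t) (β t) = N.normalChart p (x t)) :
    deriv s a ^ 2 + (N.Γ (s a) * deriv β a) ^ 2 = N.metric p (x a) (deriv x a) (deriv x a) := by
  have hΓ := chart_Γ_sq (chart_eq hp hev.self_of_nhds).2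
  rcases eq_or_ne (x a) 0 with h0 | h0
  · obtain ⟨r', hr'⟩ := exists_velocity_eq hp hx hs hβ hev
    have hΓ0 : N.Γ (s a) = 0 := by simpa [h0] using hΓ
    have := congrArg (fun z : ℂ => ‖z‖ ^ 2) hr'
    have h1 := deriv_pole_sq hΓ0
    have h2 := deriv_pole_sq hp
    simp [hΓ0, h0, mul_pow, Complex.norm_exp_ofReal_mul_I, ratio_zero, h1, h2] at this
    simp [hΓ0, h0, metric, ratio_zero, h2, this]
  · have h1 := Γ_mul_deriv_eq hp hx hs hev
    have h2 := Γ_sq_mul_deriv_eq hp hx hs hβ hev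
    rw [metric_angular] at h2
    have hn : ‖x a‖ ≠ 0 := norm_ne_zero_iff.2 h0
    have hr0 := ratio_ne_zero hp (norm_nonneg (x a)) hr
    rw [metric_self _ _ h0]
    have hΓ0 : N.Γ (s a) ^ 2 ≠ 0 := by rw [hΓ]; positivity
    apply mul_left_cancel₀ hΓ0
    set R := N.ratio p ‖x a‖
    set I := (x a).re * (deriv x a).im - (x a).im * (deriv x a).re
    have e1 : N.Γ (s a) ^ 2 * (deriv s a ^ 2 + (N.Γ (s a) * deriv β a) ^ 2)
      = (N.Γ (s a) * deriv s a) ^ 2 + (N.Γ (s a) ^ 2 * deriv β a) ^ 2 := by ring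
    rw [e1, h1, h2, hΓ]
    field_simp

/-- Conservation of angular momentum. -/
theorem hasDerivAt_momentum {μ k b c : ℝ} (hp : N.Γ p = 0) (ha : 0 < a)
    (hx : HasDerivAt x (deriv x a) a) (hx' : HasDerivAt (deriv x) (deriv (deriv x) a) a)
    (hr : ENNReal.ofReal ‖x a‖ < N.radius) (heq : N.EquationAt μ k b c p x a) :
    HasDerivAt (fun t => t * N.metric p (x t) (deriv x t) (Complex.I * x t)
      + c * N.F (p + ‖x t‖)) 0 a := by
  have h1 := (hasDerivAt_id a).mul (hasDerivAt_metric hp hx hx' (hx.const_mul Complex.I))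
  have hF := hasFDerivAt_radial (N := N) (f := N.F) (f' := fun _ => 1)
    (fun t => by simpa using N.hasDerivAt_F t) hp (x a)
  have h2 := (hF.comp_hasDerivAt a hx).const_mul c
  have h := heq (Complex.I * x a)
  -- `G` is constant along rotations; were it not differentiable, `fderiv` would be 0 by convention.
  have hG : fderiv ℝ (fun y : ℂ => N.G k b (p + ‖y‖)) (x a) (Complex.I * x a) = 0 := by
    by_cases hd : DifferentiableAt ℝ (fun y : ℂ => N.G k b (p + ‖y‖)) (x a)
    · have h3 := HasFDerivAt.comp_hasDerivAt (l := fun y : ℂ => N.G k b (p + ‖y‖)) 0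
        (by simpa using hd.hasFDerivAt) (hasDerivAt_rotation (x a))
      have h4 : (fun y : ℂ => N.G k b (p + ‖y‖)) ∘ (fun t : ℝ =>
          Complex.exp (t * Complex.I) * x a) = fun _ => N.G k b (p + ‖x a‖) := by
        funext t
        simp only [Function.comp_apply, norm_rotation]
      rw [h4] at h3
      simpa using h3.unique (hasDerivAt_const _ _)
    · rw [fderiv_zero_of_not_differentiableAt hd]; simp
  have hI : inner ℝ (x a) (Complex.I * x a) = 0 := by
    simp; ring
  have ha' : a * a⁻¹ = 1 := mul_inv_cancel₀ ha.ne'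
  rw [covAccel, fderiv_metric_angular hp, hF.fderiv, hG, metric_J_angular _ _
    (ratio_ne_zero hp (norm_nonneg _) hr)] at h
  refine (h1.add h2).congr_deriv ?_
  simp only [id, mul_one, smul_apply, innerSL_apply_apply, smul_eq_mul] at h ⊢
  rw [hI] at h
  linear_combination a * h - (N.metric p (x a) (deriv x a) (Complex.I * x a)
    + c * (N.ratio p ‖x a‖ * inner ℝ (x a) (deriv x a))) * ha'

end

/-- The derivative of `G` divided by `Γ`. -/
def slopeG (N : RevolutionSurface) (k b s : ℝ) : ℝ :=
  k ^ 2 * deriv N.Γ s + b * k - 2 * k ^ 2 * N.F s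

theorem hasDerivAt_G (N : RevolutionSurface) (k b s : ℝ) :
    HasDerivAt (N.G k b) (N.Γ s * N.slopeG k b s) s := by
  have h := ((((N.hasDerivAt_Γ s).pow 2).const_mul (k ^ 2 / 2)).add
    ((N.hasDerivAt_F s).const_mul (b * k))).sub (((N.hasDerivAt_F s).pow 2).const_mul (k ^ 2))
  refine h.congr_deriv ?_
  rw [slopeG]; push_cast; ring

section

variable {x : ℝ → ℂ} {s β : ℝ → ℝ} {a : ℝ}

/-- The equation is paired with the velocity: by metric compatibility the covariant term is the
derivative of half the squared speed. -/
theorem hasDerivAt_energy {μ k b c : ℝ} (hp : N.Γ p = 0)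
    (hx : HasDerivAt x (deriv x a) a) (hx' : HasDerivAt (deriv x) (deriv (deriv x) a) a)
    (heq : N.EquationAt μ k b c p x a) :
    HasDerivAt (fun t => N.metric p (x t) (deriv x t) (deriv x t) / 2 - μ * N.F (p + ‖x t‖))
      (-N.metric p (x a) (deriv x a) (deriv x a) / a
        - N.slopeG k b (p + ‖x a‖) * (N.ratio p ‖x a‖ * inner ℝ (x a) (deriv x a)) / a ^ 2) a := by
  have h1 := (hasDerivAt_metric hp hx hx' hx').div_const 2
  have hF := hasFDerivAt_radial (N := N) (f := N.F) (f' := fun _ => 1)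
    (fun t => by simpa using N.hasDerivAt_F t) hp (x a)
  have hG := hasFDerivAt_radial (N := N) (N.hasDerivAt_G k b) hp (x a)
  have h2 := (hF.comp_hasDerivAt a hx).const_mul μ
  have h := heq (deriv x a)
  rw [covAccel, hF.fderiv, hG.fderiv, metric_J_self] at h
  refine (h1.sub h2).congr_deriv ?_
  simp only [mul_one, smul_apply, innerSL_apply_apply, smul_eq_mul] at h ⊢
  rw [metric_comm (x a) (deriv x a) (deriv (deriv x) a)]
  linear_combination h

/-- The equation is paired with the position vector x, which is ρ ∂_s. -/
theorem radial_equation {μ k b c : ℝ} (hp : N.Γ p = 0)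
    (hx : HasDerivAt x (deriv x a) a) (hx' : HasDerivAt (deriv x) (deriv (deriv x) a) a)
    (h0 : x a ≠ 0) (heq : N.EquationAt μ k b c p x a) :
    inner ℝ (x a) (deriv (deriv x) a) +
      (1 - N.ratio p ‖x a‖ * deriv N.Γ (p + ‖x a‖)) *
        (((x a).re * (deriv x a).im - (x a).im * (deriv x a).re) / ‖x a‖) ^ 2
      + 1 / a * inner ℝ (x a) (deriv x a)
      + 1 / a ^ 2 * (N.slopeG k b (p + ‖x a‖) * (N.ratio p ‖x a‖ * ‖x a‖ ^ 2))
      - μ * (N.ratio p ‖x a‖ * ‖x a‖ ^ 2)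
      - c / a * (N.ratio p ‖x a‖ * ((x a).re * (deriv x a).im - (x a).im * (deriv x a).re)) = 0 := by
  have hF := hasFDerivAt_radial (N := N) (f := N.F) (f' := fun _ => 1)
    (fun t => by simpa using N.hasDerivAt_F t) hp (x a)
  have hG := hasFDerivAt_radial (N := N) (N.hasDerivAt_G k b) hp (x a)
  have h := heq (x a)
  have h1 := hasDerivAt_metric hp hx hx' hx
  have h2 := hx'.inner ℝ hx
  -- By the Gauss lemma g(x', x) is Euclidean. Differentiating it in both forms eliminates the
  -- derivative of the metric along the velocity.
  have h3 := h1.unique (h2.congr_of_eventuallyEq (.of_forall fun t => metric_radial _ _))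
  rw [covAccel, hF.fderiv, hG.fderiv, metric_J_radial, fderiv_metric_radial hp _ _ h0] at h
  simp only [mul_one, smul_apply, innerSL_apply_apply, smul_eq_mul,
    real_inner_self_eq_norm_sq, metric_radial] at h h3
  rw [metric_self _ _ h0] at h3
  have h4 : ‖deriv x a‖ ^ 2 = (inner ℝ (x a) (deriv x a) / ‖x a‖) ^ 2 +
      (((x a).re * (deriv x a).im - (x a).im * (deriv x a).re) / ‖x a‖) ^ 2 := by
    have hn : ‖x a‖ ^ 2 ≠ 0 := by simpa using h0
    rw [div_pow, div_pow, ← add_div, eq_div_iff hn, Complex.sq_norm_eq_re_im,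
      Complex.sq_norm_eq_re_im, Complex.real_inner_eq]
    ring
  rw [real_inner_comm (deriv (deriv x) a) (x a)]
  rw [real_inner_comm (x a) (deriv x a)] at h
  rw [mul_pow] at h3
  linear_combination h - h3 - h4

end

end RevolutionSurface

theorem ContDiffAt.hasDerivAt_deriv_of_two {x : ℝ → ℂ} {a : ℝ} (h : ContDiffAt ℝ 2 x a) :
    HasDerivAt (deriv x) (deriv (deriv x) a) a := by
  have h1 : ContDiffAt ℝ 1 (fderiv ℝ x) a := h.fderiv_right (by norm_num)
  have h2 : DifferentiableAt ℝ (fun t => fderiv ℝ x t 1) a :=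
    (h1.differentiableAt (by norm_num)).clm_apply (differentiableAt_const _)
  exact DifferentiableAt.hasDerivAt h2

/-! ### Equations for the polar lift -/

namespace RevolutionSurface

variable {N : RevolutionSurface} {μ k b c : ℝ} {W : ℝ → N.Point} {s β : ℝ → ℝ}

theorem slopeG_eq_of_F_eq {s t : ℝ} (h : N.F s = N.F t) : N.slopeG k b s = N.slopeG k b t := by
  rw [slopeG, slopeG, h, N.deriv_Γ_eq_of_F_eq h]

/-- A solution has, near each time, a normal coordinate in which it is a `C²` curve. -/
theorem exists_chart (hW : N.IsSolutionOn μ k b c W (Set.Ioi 0))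
    (hlift : N.IsPolarLift W s β (Set.Ioi 0)) {a : ℝ} (ha : 0 < a) :
    ∃ (p : ℝ) (x : ℝ → ℂ), N.Γ p = 0 ∧ (∀ᶠ t in 𝓝 a, DifferentiableAt ℝ x t) ∧
      HasDerivAt (deriv x) (deriv (deriv x) a) a ∧
      (∀ᶠ t in 𝓝 a, ENNReal.ofReal ‖x t‖ < N.radius) ∧
      (∀ᶠ t in 𝓝 a, N.expO (s t) (β t) = N.normalChart p (x t)) ∧
      N.EquationAt μ k b c p x a := by
  obtain ⟨p, x, hp, hx, hev, heq⟩ := hW a ha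
  refine ⟨p, x, hp, ?_, hx.hasDerivAt_deriv_of_two, hev.mono fun t h => h.1, ?_, heq⟩
  · filter_upwards [hx.eventually (by simp)] with t ht using ht.differentiableAt (by norm_num)
  · filter_upwards [hev, lt_mem_nhds ha] with t ht ht0
    rw [← ht.2, (hlift t ht0).2.2]

theorem IsSolutionOn.hasDerivAt_momentum (hW : N.IsSolutionOn μ k b c W (Set.Ioi 0))
    (hlift : N.IsPolarLift W s β (Set.Ioi 0)) {a : ℝ} (ha : 0 < a) :
    HasDerivAt (fun t => t * (N.Γ (s t) ^ 2 * deriv β t) + c * N.F (s t)) 0 a := by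
  obtain ⟨p, x, hp, hx, hx', hr, hev, heq⟩ := exists_chart hW hlift ha
  refine (RevolutionSurface.hasDerivAt_momentum hp ha hx.self_of_nhds.hasDerivAt hx' hr.self_of_nhds
    heq).congr_of_eventuallyEq ?_
  filter_upwards [hx, hev.eventually_nhds, lt_mem_nhds ha] with t h1 h2 h3
  rw [Γ_sq_mul_deriv_eq hp h1 (hlift t h3).1 (hlift t h3).2.1 h2, (chart_eq hp h2.self_of_nhds).1]

theorem IsSolutionOn.hasDerivAt_energy (hW : N.IsSolutionOn μ k b c W (Set.Ioi 0))
    (hlift : N.IsPolarLift W s β (Set.Ioi 0)) {a : ℝ} (ha : 0 < a) :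
    HasDerivAt (fun t => (deriv s t ^ 2 + N.sigma s β t ^ 2) / 2 - μ * N.F (s t))
      (-(deriv s a ^ 2 + N.sigma s β a ^ 2) / a
        - N.slopeG k b (s a) * (N.Γ (s a) * deriv s a) / a ^ 2) a := by
  obtain ⟨p, x, hp, hx, hx', hr, hev, heq⟩ := exists_chart hW hlift ha
  have h := RevolutionSurface.hasDerivAt_energy hp hx.self_of_nhds.hasDerivAt hx' heq
  rw [← Γ_mul_deriv_eq hp hx.self_of_nhds (hlift a ha).1 hev,
    ← slopeG_eq_of_F_eq (chart_eq hp hev.self_of_nhds).1,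
    ← speed_sq_eq hp hx.self_of_nhds (hlift a ha).1 (hlift a ha).2.1 hr.self_of_nhds hev] at h
  refine h.congr_of_eventuallyEq ?_
  filter_upwards [hx, hev.eventually_nhds, lt_mem_nhds ha, hr] with t h1 h2 h3 h4
  rw [← speed_sq_eq hp h1 (hlift t h3).1 (hlift t h3).2.1 h4 h2, (chart_eq hp h2.self_of_nhds).1,
    sigma]

/-- Only first derivatives of the lift are given. Away from the poles s' = ratio · ⟨x, x'⟩ / Γ(s) is
a quotient of differentiable functions, and the radial equation evaluates its derivative. -/
theorem IsSolutionOn.hasDerivAt_deriv (hW : N.IsSolutionOn μ k b c W (Set.Ioi 0))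
    (hlift : N.IsPolarLift W s β (Set.Ioi 0)) {a : ℝ} (ha : 0 < a) (hΓ : N.Γ (s a) ≠ 0) :
    HasDerivAt (deriv s) (N.Γ (s a) * deriv N.Γ (s a) * deriv β a ^ 2 - deriv s a / a
      - N.Γ (s a) * N.slopeG k b (s a) / a ^ 2 + μ * N.Γ (s a)
      + c / a * (N.Γ (s a) * deriv β a)) a := by
  obtain ⟨p, x, hp, hx, hx', hr, hev, heq⟩ := exists_chart hW hlift ha
  have hF := (chart_eq hp hev.self_of_nhds).1
  have hΓsq := chart_Γ_sq (chart_eq hp hev.self_of_nhds).2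
  have h0 : x a ≠ 0 := by
    intro h0
    rw [h0] at hΓsq
    simp at hΓsq
    exact hΓ hΓsq
  have hn : ‖x a‖ ≠ 0 := norm_ne_zero_iff.2 h0
  have hd := hx.self_of_nhds.hasDerivAt
  have hrad := radial_equation hp hd hx' h0 heq
  rw [← slopeG_eq_of_F_eq hF, ← N.deriv_Γ_eq_of_F_eq hF] at hrad
  have hs' := Γ_mul_deriv_eq hp hx.self_of_nhds (hlift a ha).1 hev
  have hβ' := Γ_sq_mul_deriv_eq hp hx.self_of_nhds (hlift a ha).1 (hlift a ha).2.1 hev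
  rw [metric_angular] at hβ'
  have h1 := (HasDerivAt.comp (h₂ := N.ratio p) a (hasDerivAt_ratio hp hn)
    (hasDerivAt_norm_complex hd h0)).mul (hd.inner ℝ hx')
  have h2 := (N.hasDerivAt_Γ (s a)).comp a (hlift a ha).1.hasDerivAt
  have h3 := h1.div h2 hΓ
  have hev' : deriv s =ᶠ[𝓝 a] ((N.ratio p ∘ fun t => ‖x t‖) *
      fun t => inner ℝ (x t) (deriv x t)) / (N.Γ ∘ s) := by
    have hc : ∀ᶠ t in 𝓝 a, N.Γ (s t) ≠ 0 := h2.continuousAt.eventually_ne hΓ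
    filter_upwards [hx, hev.eventually_nhds, lt_mem_nhds ha, hc] with t g1 g2 g3 g4
    simp only [Pi.div_apply, Pi.mul_apply, Function.comp_apply]
    rw [← Γ_mul_deriv_eq hp g1 (hlift t g3).1 g2]
    field_simp
  refine (h3.congr_of_eventuallyEq hev').congr_deriv ?_
  simp only [Pi.mul_apply, Function.comp_apply]
  rw [← N.deriv_Γ_eq_of_F_eq hF, real_inner_self_eq_norm_sq]
  have hw : ‖deriv x a‖ ^ 2 = (inner ℝ (x a) (deriv x a) / ‖x a‖) ^ 2 +
      (((x a).re * (deriv x a).im - (x a).im * (deriv x a).re) / ‖x a‖) ^ 2 := by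
    have hn : ‖x a‖ ^ 2 ≠ 0 := by simpa using h0
    rw [div_pow, div_pow, ← add_div, eq_div_iff hn, Complex.sq_norm_eq_re_im,
      Complex.sq_norm_eq_re_im, Complex.real_inner_eq]
    ring
  rw [hw]
  generalize inner ℝ (x a) (deriv x a) = P at *
  generalize (x a).re * (deriv x a).im - (x a).im * (deriv x a).re = I at *
  generalize inner ℝ (x a) (deriv (deriv x) a) = X at *
  generalize N.ratio p ‖x a‖ = r at *
  generalize ‖x a‖ = ρ at *
  generalize N.Γ (s a) = G at *
  generalize deriv N.Γ (s a) = D at *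
  generalize deriv s a = v at *
  generalize deriv β a = B at *
  generalize N.slopeG k b (s a) = g at *
  have hr0 : r ≠ 0 := by
    intro hr; simp [hr] at hΓsq; exact hΓ hΓsq
  -- The first-order identities are squared, since s and ρ may differ in sign; only even
  -- combinations of them enter the equation.
  have hv : v ^ 2 = P ^ 2 / ρ ^ 2 := by
    rw [eq_div_iff (by positivity)]
    apply mul_left_cancel₀ (pow_ne_zero 2 hr0)
    linear_combination (-v ^ 2) * hΓsq + (G * v + r * P) * hs'
  have hB : G ^ 2 * B ^ 2 = r ^ 2 * I ^ 2 / ρ ^ 2 := by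
    rw [eq_div_iff (by positivity)]
    apply mul_left_cancel₀ (pow_ne_zero 2 hr0)
    linear_combination (-G ^ 2 * B ^ 2) * hΓsq + (G ^ 2 * B + r ^ 2 * I) * hβ'
  have hX : X = -((1 - r * D) * (I / ρ) ^ 2 + 1 / a * P + 1 / a ^ 2 * (g * (r * ρ ^ 2))
    - μ * (r * ρ ^ 2) - c / a * (r * I)) := by linear_combination hrad
  have e : ((D - r) / ρ * (P / ρ) * P + r * (X + ((P / ρ) ^ 2 + (I / ρ) ^ 2))) * G
      - r * P * (D * v) = G * (D * (G ^ 2 * B ^ 2) - G * v / a - g * G ^ 2 / a ^ 2 + μ * G ^ 2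
        + c / a * (G ^ 2 * B)) := by
    have t : r * P * (D * v) = G * (D * (P ^ 2 / ρ ^ 2)) := by rw [← hs', ← hv]; ring
    rw [t, hB, hβ', hX, hs', hΓsq]
    field_simp
    ring
  rw [e]
  field_simp

end RevolutionSurface

/-! ### Grönwall estimates, angular momentum and positivity of the energy -/

/-- Grönwall's inequality in differential form, with an integrating factor. -/
theorem antitoneOn_mul_exp_neg {S : Set ℝ} (hS : Convex ℝ S) {Q Q' ψ ψ' : ℝ → ℝ}
    (hQ : ∀ t ∈ S, HasDerivAt Q (Q' t) t) (hψ : ∀ t ∈ S, HasDerivAt ψ (ψ' t) t)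
    (h : ∀ t ∈ S, Q' t ≤ ψ' t * Q t) :
    AntitoneOn (fun t => Q t * Real.exp (-ψ t)) S := by
  have hd : ∀ t ∈ S, HasDerivAt (fun t => Q t * Real.exp (-ψ t))
      ((Q' t - ψ' t * Q t) * Real.exp (-ψ t)) t := fun t ht =>
    ((hQ t ht).mul (hψ t ht).neg.exp).congr_deriv
      (by simp only [Pi.neg_apply]; ring)
  apply antitoneOn_of_deriv_nonpos hS (fun t ht => (hd t ht).continuousAt.continuousWithinAt)
    (fun t ht => (hd t (interior_subset ht)).differentiableAt.differentiableWithinAt)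
  intro t ht
  rw [(hd t (interior_subset ht)).deriv]
  exact mul_nonpos_of_nonpos_of_nonneg (sub_nonpos.2 (h t (interior_subset ht)))
    (Real.exp_pos _).le

/-- A nonnegative function with `|Q'| ≤ K Q` that vanishes somewhere vanishes identically. -/
theorem eq_zero_of_abs_deriv_le_mul {S : Set ℝ} (hS : Convex ℝ S) {Q Q' : ℝ → ℝ} {K : ℝ}
    (hQ : ∀ t ∈ S, HasDerivAt Q (Q' t) t) (h0 : ∀ t ∈ S, 0 ≤ Q t)
    (h : ∀ t ∈ S, |Q' t| ≤ K * Q t) {a b : ℝ} (ha : a ∈ S) (hb : b ∈ S) (hQa : Q a = 0) :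
    Q b = 0 := by
  refine le_antisymm ?_ (h0 b hb)
  have hK : ∀ t : ℝ, HasDerivAt (fun t => K * t) K t := fun t => by
    simpa using (hasDerivAt_id t).const_mul K
  rcases le_total a b with hab | hab
  · have := antitoneOn_mul_exp_neg hS hQ (fun t _ => hK t)
      (fun t ht => (le_abs_self _).trans (h t ht)) ha hb hab
    simp only [hQa, zero_mul] at this
    by_contra hlt
    push Not at hlt
    have := mul_pos hlt (Real.exp_pos (-(K * b)))
    linarith
  -- For times before a, the estimate is applied to -Q with exponent -Kt.
  · have := antitoneOn_mul_exp_neg hS (fun t ht => (hQ t ht).neg) (fun t _ => (hK t).neg)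
      (fun t ht => by
        have := (neg_le_abs _).trans (h t ht)
        simpa using this) hb ha hab
    simp only [Pi.neg_apply, hQa, neg_zero, zero_mul] at this
    by_contra hlt
    push Not at hlt
    have := mul_pos hlt (Real.exp_pos (-(-(K * b))))
    linarith

namespace RevolutionSurface

variable {N : RevolutionSurface} {μ k b c : ℝ} {W : ℝ → N.Point} {s β : ℝ → ℝ}

theorem continuous_slopeG : Continuous (N.slopeG k b) := by
  unfold slopeG
  have := N.continuous_deriv_Γ
  have := N.continuous_F
  fun_prop

theorem tendsto_F_and_Γ_of_tendsto_origin {l : Filter ℝ} (hlift : ∀ᶠ t in l, W t = N.expO (s t) (β t))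
    (hW0 : Tendsto W l (𝓝 N.origin)) :
    Tendsto (fun t => N.F (s t)) l (𝓝 0) ∧ Tendsto (fun t => |N.Γ (s t)|) l (𝓝 0) := by
  have h1 := tendsto_subtype_rng.1 hW0
  have h0 : (N.origin : ℝ × ℂ) = (0, 0) := by simp [origin, expO, polar]
  rw [h0, nhds_prod_eq] at h1
  have hF := tendsto_fst.comp h1
  have hΓ := (tendsto_snd.comp h1).norm
  rw [norm_zero] at hΓ
  constructor
  · refine hF.congr' ?_
    filter_upwards [hlift] with t ht
    simp [ht, expO, polar]
  · refine hΓ.congr' ?_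
    filter_upwards [hlift] with t ht
    simp [ht, expO, polar, Complex.norm_exp_ofReal_mul_I]

/-- The angular momentum of a solution starting from the center. -/
theorem IsSolutionOn.momentum_eq (hW : N.IsSolutionOn μ k b c W (Set.Ioi 0))
    (hlift : N.IsPolarLift W s β (Set.Ioi 0))
    (hW0 : Tendsto W (𝓝[>] 0) (𝓝 N.origin))
    (hWa0 : Tendsto (fun a => a * N.speed s β a) (𝓝[>] 0) (𝓝 0)) {a : ℝ} (ha : 0 < a) :
    a * (N.Γ (s a) ^ 2 * deriv β a) = -(c * N.F (s a)) := by
  obtain ⟨d, hd⟩ := isOpen_Ioi.exists_is_const_of_deriv_eq_zero isPreconnected_Ioi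
    (fun t ht => (hW.hasDerivAt_momentum hlift ht).differentiableAt.differentiableWithinAt)
    (fun t ht => (hW.hasDerivAt_momentum hlift ht).deriv)
  obtain ⟨hF, hΓ⟩ := tendsto_F_and_Γ_of_tendsto_origin (N := N) (s := s) (β := β)
    (by filter_upwards [self_mem_nhdsWithin] with t ht using (hlift t ht).2.2) hW0
  -- The conserved quantity is evaluated in the limit t → 0: this term is at most |Γ| · t|W_a|, and
  -- `F` tends to 0.
  have h1 : Tendsto (fun t => t * (N.Γ (s t) ^ 2 * deriv β t)) (𝓝[>] 0) (𝓝 0) := by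
    have h2 := hΓ.mul hWa0
    rw [mul_zero] at h2
    refine squeeze_zero_norm' ?_ h2
    filter_upwards [self_mem_nhdsWithin] with t ht
    have ht' : (0 : ℝ) < t := ht
    have h3 : |N.sigma s β t| ≤ N.speed s β t := by
      rw [speed]
      exact Real.abs_le_sqrt (by nlinarith [sq_nonneg (deriv s t)])
    have h4 : t * (N.Γ (s t) ^ 2 * deriv β t) = N.Γ (s t) * (t * N.sigma s β t) := by
      rw [sigma]; ring
    rw [h4, Real.norm_eq_abs, abs_mul, abs_mul, abs_of_pos ht']
    gcongr
  have h2 := h1.add (hF.const_mul c)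
  have h3 : Tendsto (fun _ : ℝ => d) (𝓝[>] (0 : ℝ)) (𝓝 0) := by
    simp only [mul_zero, add_zero] at h2
    refine h2.congr' ?_
    filter_upwards [self_mem_nhdsWithin] with t ht using hd t ht
  have h4 := tendsto_nhds_unique h3 tendsto_const_nhds
  have := hd a ha
  linarith

theorem sigma_eq_of_momentum_eq {a : ℝ} (ha : 0 < a)
    (h : a * (N.Γ (s a) ^ 2 * deriv β a) = -(c * N.F (s a))) :
    N.sigma s β a = -(c * N.F (s a)) / (a * N.Γ (s a)) := by
  rw [← h, sigma]
  rcases eq_or_ne (N.Γ (s a)) 0 with h0 | h0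
  -- At a pole both sides are 0, division by zero giving the limiting value at O.
  · simp [h0]
  · field_simp

/-- A solution other than the constant `O` has positive energy at every time. -/
theorem IsSolutionOn.energy_pos (hμ : μ < 0) (hW : N.IsSolutionOn μ k b c W (Set.Ioi 0))
    (hlift : N.IsPolarLift W s β (Set.Ioi 0)) (hne : ∃ a, 0 < a ∧ W a ≠ N.origin) {a : ℝ}
    (ha : 0 < a) : 0 < (deriv s a ^ 2 + N.sigma s β a ^ 2) / 2 - μ * N.F (s a) := by
  have hFμ : ∀ t, 0 ≤ -μ * N.F (s t) := fun t => mul_nonneg (by linarith) (N.F_nonneg _)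
  have hnn : ∀ t, 0 ≤ (deriv s t ^ 2 + N.sigma s β t ^ 2) / 2 - μ * N.F (s t) := fun t => by
    have := hFμ t
    have : 0 ≤ (deriv s t ^ 2 + N.sigma s β t ^ 2) / 2 := by positivity
    linarith
  refine lt_of_le_of_ne (hnn a) fun h0 => ?_
  obtain ⟨d, hd, hWd⟩ := hne
  set S := Set.uIcc a d
  have hSpos : ∀ t ∈ S, 0 < t := fun t ht => (lt_min ha hd).trans_le ht.1
  set α := min a d
  have hα : 0 < α := lt_min ha hd
  have hsc : ContinuousOn s S := fun t ht =>
    (hlift t (hSpos t ht)).1.continuousAt.continuousWithinAt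
  obtain ⟨R, hR⟩ := isCompact_uIcc.exists_bound_of_continuousOn hsc
  obtain ⟨B, hB⟩ := isCompact_uIcc.exists_bound_of_continuousOn
    ((continuous_slopeG (N := N) (k := k) (b := b)).comp_continuousOn hsc)
  obtain ⟨M, hM0, hM⟩ := N.exists_Γ_sq_le R
  -- In K, the term 2/α bounds the damping. The other bounds the work of ∇G, using |Γ s'| ≤ (Γ² +
  -- s'²)/2, Γ² ≤ M F and F ≤ E/(-μ) for the energy E.
  have hEd := eq_zero_of_abs_deriv_le_mul (convex_uIcc a d)
    (K := 2 / α + B * (M / (-μ) + 1) / α ^ 2)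
    (fun t ht => hW.hasDerivAt_energy hlift (hSpos t ht)) (fun t _ => hnn t) (fun t ht => ?_)
    Set.left_mem_uIcc Set.right_mem_uIcc h0.symm
  · have h1 : N.F (s d) = 0 := by
      have h2 : 0 ≤ (deriv s d ^ 2 + N.sigma s β d ^ 2) / 2 := by positivity
      have h3 : μ * N.F (s d) = 0 := by have := hFμ d; linarith
      exact (mul_eq_zero.1 h3).resolve_left hμ.ne
    apply hWd
    rw [(hlift d hd).2.2]
    apply Subtype.ext
    simp [origin, expO, polar, h1, N.Γ_eq_zero_of_F_eq_zero h1]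
  · have ht0 := hSpos t ht
    have hαt : α ≤ t := ht.1
    have hBt := hB t ht
    have hB0 : 0 ≤ B := (norm_nonneg _).trans hBt
    have hE := hnn t
    set En := (deriv s t ^ 2 + N.sigma s β t ^ 2) / 2 - μ * N.F (s t) with hEn
    have e1 : deriv s t ^ 2 + N.sigma s β t ^ 2 ≤ 2 * En := by have := hFμ t; linarith
    have e2 : N.F (s t) ≤ En / (-μ) := by
      rw [le_div_iff₀ (by linarith)]
      have : 0 ≤ (deriv s t ^ 2 + N.sigma s β t ^ 2) / 2 := by positivity
      linarith
    have e3 : |N.Γ (s t) * deriv s t| ≤ (M / (-μ) + 1) * En := by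
      have h1 := hM (s t) (hR t ht)
      have h2 : M * N.F (s t) ≤ M * (En / (-μ)) := by gcongr
      have h3 : deriv s t ^ 2 ≤ 2 * En := by nlinarith [sq_nonneg (N.sigma s β t)]
      have h4 : |N.Γ (s t) * deriv s t| ≤ (N.Γ (s t) ^ 2 + deriv s t ^ 2) / 2 := by
        rw [abs_le]
        constructor <;> nlinarith [sq_nonneg (N.Γ (s t) - deriv s t),
          sq_nonneg (N.Γ (s t) + deriv s t)]
      have h5 : 0 ≤ M * (En / (-μ)) := mul_nonneg hM0 (div_nonneg hE (by linarith))
      have h6 : (M / (-μ) + 1) * En = M * (En / (-μ)) + En := by ring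
      linarith
    have e4 : |-(deriv s t ^ 2 + N.sigma s β t ^ 2) / t| ≤ 2 / α * En := by
      rw [abs_div, abs_neg, abs_of_nonneg (by positivity), abs_of_pos ht0, div_mul_eq_mul_div]
      exact div_le_div₀ (by positivity) e1 hα hαt
    have e5 : |N.slopeG k b (s t) * (N.Γ (s t) * deriv s t) / t ^ 2|
        ≤ B * (M / (-μ) + 1) / α ^ 2 * En := by
      rw [abs_div, abs_mul, abs_of_pos (by positivity : 0 < t ^ 2), div_mul_eq_mul_div]
      have : 0 ≤ B * (M / (-μ) + 1) * En := by
        have : 0 ≤ M / (-μ) := div_nonneg hM0 (by linarith)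
        positivity
      refine div_le_div₀ this ?_ (by positivity) (by gcongr)
      rw [mul_assoc]
      exact mul_le_mul hBt e3 (abs_nonneg _) hB0
    refine (abs_sub _ _).trans ?_
    rw [add_mul]
    exact add_le_add e4 e5

/-- Two-sided bounds for `Γ` and `F` on a closed disc around the center. -/
theorem exists_bounds {R : ℝ} (hR : ENNReal.ofReal R < N.radius) :
    ∃ κ K, 0 < κ ∧ κ ≤ K ∧ ∀ s, |s| ≤ R → κ * s ^ 2 ≤ s * N.Γ s ∧ κ * |s| ≤ |N.Γ s| ∧
      |N.Γ s| ≤ K * |s| ∧ κ / 2 * s ^ 2 ≤ N.F s ∧ N.F s ≤ K / 2 * s ^ 2 := by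
  have hmr : ∀ s, s * N.ratio 0 s = N.Γ s := fun s => by simpa using mul_ratio N.Γ_zero s
  have hcont : Continuous (N.ratio 0) := by
    refine continuous_iff_continuousAt.2 fun ρ => ?_
    rcases eq_or_ne ρ 0 with rfl | h
    · exact continuousAt_dslope_same.2 hasDerivAt_Γ_pole.differentiableAt
    · exact (hasDerivAt_ratio N.Γ_zero h).continuousAt
  have hpos : ∀ s, |s| ≤ R → 0 < N.ratio 0 s := by
    intro s hs
    have hlt : ENNReal.ofReal |s| < N.radius := (ENNReal.ofReal_le_ofReal hs).trans_lt hR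
    rcases eq_or_ne s 0 with rfl | h
    · rw [ratio_zero, N.deriv_Γ_zero]; exact one_pos
    · have h1 : 0 < s ^ 2 * N.ratio 0 s := by
        have h2 : s ^ 2 * N.ratio 0 s = |s| * N.Γ |s| := by
          rw [pow_two, mul_assoc, hmr]
          rcases abs_choice s with h | h <;> rw [h]
          rw [N.odd]; ring
        rw [h2]
        exact mul_pos (abs_pos.2 h) (N.Γ_pos (abs_pos.2 h) hlt)
      exact pos_of_mul_pos_right h1 (sq_nonneg _)
  -- The constants are the extrema of the continuous positive function Γ(s)/s on [-R, R]; for R < 0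
  -- the claim is vacuous.
  obtain ⟨κ, K, hκ, hκK, hb⟩ : ∃ κ K, 0 < κ ∧ κ ≤ K ∧ ∀ s, |s| ≤ R →
      κ ≤ N.ratio 0 s ∧ N.ratio 0 s ≤ K := by
    by_cases hR0 : 0 ≤ R
    · have hne : (Set.Icc (-R) R).Nonempty := ⟨0, by linarith, hR0⟩
      obtain ⟨x, hx, hmin⟩ := isCompact_Icc.exists_isMinOn hne hcont.continuousOn
      obtain ⟨y, hy, hmax⟩ := isCompact_Icc.exists_isMaxOn hne hcont.continuousOn
      exact ⟨_, _, hpos x (abs_le.2 hx), hmin hy, fun s hs =>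
        ⟨hmin (abs_le.1 hs), hmax (abs_le.1 hs)⟩⟩
    · exact ⟨1, 1, one_pos, le_rfl, fun s hs => absurd ((abs_nonneg s).trans hs) hR0⟩
  have hΓ : ∀ s, |s| ≤ R → κ * s ^ 2 ≤ s * N.Γ s ∧ κ * |s| ≤ |N.Γ s| ∧ |N.Γ s| ≤ K * |s| := by
    intro s hs
    obtain ⟨h1, h2⟩ := hb s hs
    have h3 := hpos s hs
    have e : |N.Γ s| = N.ratio 0 s * |s| := by rw [← hmr, abs_mul, abs_of_pos h3, mul_comm]
    refine ⟨?_, ?_, ?_⟩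
    · rw [← hmr]; nlinarith [mul_le_mul_of_nonneg_right h1 (sq_nonneg s)]
    · rw [e]; gcongr
    · rw [e]; gcongr
  have hF : ∀ u, 0 ≤ u → u ≤ R → κ / 2 * u ^ 2 ≤ N.F u ∧ N.F u ≤ K / 2 * u ^ 2 := by
    intro u hu huR
    have hd : ∀ (q x : ℝ), HasDerivAt (fun x => N.F x - q / 2 * x ^ 2) (N.Γ x - q * x) x := by
      intro q x
      refine ((N.hasDerivAt_F x).sub ((hasDerivAt_pow 2 x).const_mul (q / 2))).congr_deriv ?_
      push_cast; ring
    have hx' : ∀ x ∈ interior (Set.Icc 0 u), κ * x ≤ N.Γ x ∧ N.Γ x ≤ K * x := by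
      intro x hx
      rw [interior_Icc] at hx
      have hxR : |x| ≤ R := by rw [abs_of_pos hx.1]; linarith [hx.2]
      rw [← hmr, mul_comm x]
      exact ⟨mul_le_mul_of_nonneg_right (hb x hxR).1 hx.1.le,
        mul_le_mul_of_nonneg_right (hb x hxR).2 hx.1.le⟩
    have m1 : MonotoneOn (fun x => N.F x - κ / 2 * x ^ 2) (Set.Icc 0 u) := by
      apply monotoneOn_of_deriv_nonneg (convex_Icc _ _)
        (fun x _ => (hd κ x).continuousAt.continuousWithinAt)
        (fun x _ => (hd κ x).differentiableAt.differentiableWithinAt)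
      intro x hx
      rw [(hd κ x).deriv]
      linarith [(hx' x hx).1]
    have m2 : AntitoneOn (fun x => N.F x - K / 2 * x ^ 2) (Set.Icc 0 u) := by
      apply antitoneOn_of_deriv_nonpos (convex_Icc _ _)
        (fun x _ => (hd K x).continuousAt.continuousWithinAt)
        (fun x _ => (hd K x).differentiableAt.differentiableWithinAt)
      intro x hx
      rw [(hd K x).deriv]
      linarith [(hx' x hx).2]
    have i1 := m1 ⟨le_rfl, hu⟩ ⟨hu, le_rfl⟩ hu
    have i2 := m2 ⟨le_rfl, hu⟩ ⟨hu, le_rfl⟩ hu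
    simp at i1 i2
    exact ⟨i1, i2⟩
  refine ⟨κ, K, hκ, hκK, fun s hs => ⟨(hΓ s hs).1, (hΓ s hs).2.1, (hΓ s hs).2.2, ?_⟩⟩
  have := hF |s| (abs_nonneg s) hs
  rwa [N.F_abs, sq_abs] at this

theorem exists_radius_of_limsup_lt
    (h : limsup (fun a => ENNReal.ofReal |s a|) atTop < N.radius) :
    ∃ R, ENNReal.ofReal R < N.radius ∧ ∀ᶠ a in atTop, |s a| ≤ R := by
  obtain ⟨r, h1, h2⟩ := exists_between h
  refine ⟨r.toReal, ENNReal.ofReal_toReal_le.trans_lt h2, ?_⟩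
  filter_upwards [eventually_lt_of_limsup_lt h1] with a ha
  exact (ENNReal.ofReal_le_iff_le_toReal h2.ne_top).1 ha.le

end RevolutionSurface

/-- If the square of a derivative is differentiable where it is positive, so is the derivative. -/
theorem hasDerivAt_deriv_of_sq {s g : ℝ → ℝ} {g' a : ℝ} (hs : ∀ᶠ t in 𝓝 a, DifferentiableAt ℝ s t)
    (hg : HasDerivAt g g' a) (hsq : ∀ᶠ t in 𝓝 a, deriv s t ^ 2 = g t) (ha : deriv s a ≠ 0) :
    HasDerivAt (deriv s) (g' / (2 * deriv s a)) a := by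
  have hga : g a = deriv s a ^ 2 := hsq.self_of_nhds.symm
  have hpos : 0 < g a := by rw [hga]; positivity
  obtain ⟨ε, hε, hball⟩ := Metric.eventually_nhds_iff_ball.1
    (hs.and (hsq.and (hg.continuousAt.eventually (lt_mem_nhds hpos))))
  have hne : ∀ t ∈ Metric.ball a ε, deriv s t ≠ 0 := by
    intro t ht h0
    have h1 := (hball t ht).2.1
    have h2 := (hball t ht).2.2
    rw [← h1, h0] at h2
    simp at h2
  have hsqrt := hg.sqrt hpos.ne'
  have hmem := Metric.ball_mem_nhds a hε
  -- Darboux: a nonvanishing derivative keeps its sign, so s' is √g or -√g on the whole ball, with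
  -- no continuity of s' assumed.
  rcases hasDerivWithinAt_forall_lt_or_forall_gt_of_forall_ne (convex_ball a ε)
    (fun t ht => (hball t ht).1.hasDerivAt.hasDerivWithinAt) hne with h | h
  · have hev : deriv s =ᶠ[𝓝 a] -fun t => Real.sqrt (g t) := by
      filter_upwards [hmem] with t ht
      rw [Pi.neg_apply, ← (hball t ht).2.1, Real.sqrt_sq_eq_abs, abs_of_neg (h t ht), neg_neg]
    refine (hsqrt.neg.congr_of_eventuallyEq hev).congr_deriv ?_
    rw [hga, Real.sqrt_sq_eq_abs, abs_of_neg (h a (Metric.mem_ball_self hε))]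
    field_simp
  · have hev : deriv s =ᶠ[𝓝 a] fun t => Real.sqrt (g t) := by
      filter_upwards [hmem] with t ht
      rw [← (hball t ht).2.1, Real.sqrt_sq_eq_abs, abs_of_pos (h t ht)]
    refine (hsqrt.congr_of_eventuallyEq hev).congr_deriv ?_
    rw [hga, Real.sqrt_sq_eq_abs, abs_of_pos (h a (Metric.mem_ball_self hε))]

namespace RevolutionSurface

variable {N : RevolutionSurface} {μ k b c : ℝ} {W : ℝ → N.Point} {s β : ℝ → ℝ}

/-- The constant comes from F ≤ (K/2)s² and |Γ| ≥ κ|s|. -/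
theorem abs_sigma_le {κ K R : ℝ} (hκ : 0 < κ) (hbd : ∀ s, |s| ≤ R → κ * s ^ 2 ≤ s * N.Γ s ∧
      κ * |s| ≤ |N.Γ s| ∧ |N.Γ s| ≤ K * |s| ∧ κ / 2 * s ^ 2 ≤ N.F s ∧ N.F s ≤ K / 2 * s ^ 2)
    {a : ℝ} (ha : 0 < a) (hsa : |s a| ≤ R)
    (hσ : N.sigma s β a = -(c * N.F (s a)) / (a * N.Γ (s a))) :
    |N.sigma s β a| ≤ |c| * (K / (2 * κ)) * |s a| / a := by
  obtain ⟨-, h2, h3, -, h5⟩ := hbd _ hsa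
  rcases eq_or_ne (s a) 0 with h0 | h0
  · simp [sigma, h0]
  have hs0 : 0 < |s a| := abs_pos.2 h0
  have hΓ : 0 < |N.Γ (s a)| := lt_of_lt_of_le (by positivity) h2
  have hK : 0 ≤ K := by
    by_contra hK
    have := mul_neg_of_neg_of_pos (not_le.1 hK) hs0
    linarith
  rw [hσ, abs_div, abs_neg, abs_mul, abs_mul, abs_of_pos ha, abs_of_nonneg (N.F_nonneg _),
    div_le_div_iff₀ (by positivity) ha]
  have e1 : |c| * N.F (s a) * a ≤ |c| * (K / 2 * s a ^ 2) * a := by gcongr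
  have e2 : |c| * (K / (2 * κ)) * |s a| * (a * (κ * |s a|)) ≤
      |c| * (K / (2 * κ)) * |s a| * (a * |N.Γ (s a)|) := by gcongr
  have e3 : |c| * (K / (2 * κ)) * |s a| * (a * (κ * |s a|)) = |c| * (K / 2 * s a ^ 2) * a := by
    rw [← sq_abs (s a)]; field_simp
  linarith

/-- While the solution stays near the center, the radial coordinate solves a damped pendulum
equation with a perturbation of size `|s| / a²`. -/
theorem IsSolutionOn.exists_pendulum (hμ : μ < 0) (hW : N.IsSolutionOn μ k b c W (Set.Ioi 0))
    (hlift : N.IsPolarLift W s β (Set.Ioi 0)) (hne : ∃ a, 0 < a ∧ W a ≠ N.origin)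
    (hσ : ∀ a, 0 < a → N.sigma s β a = -(c * N.F (s a)) / (a * N.Γ (s a)))
    {R : ℝ} (hR : ENNReal.ofReal R < N.radius) :
    ∃ C, 0 ≤ C ∧ ∀ a, 0 < a → (∀ᶠ t in 𝓝 a, |s t| ≤ R) → ∃ e, |e| ≤ C * |s a| / a ^ 2 ∧
      HasDerivAt (deriv s) (-(deriv s a / a) + μ * N.Γ (s a) - e) a := by
  obtain ⟨κ, K, hκ, hκK, hbd⟩ := N.exists_bounds hR
  obtain ⟨D, hD⟩ := (isCompact_Icc (a := -R) (b := R)).exists_bound_of_continuousOn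
    N.continuous_deriv_Γ.continuousOn
  obtain ⟨B, hB⟩ := (isCompact_Icc (a := -R) (b := R)).exists_bound_of_continuousOn
    (continuous_slopeG (N := N) (k := k) (b := b)).continuousOn
  have hK : 0 < K := hκ.trans_le hκK
  set q := |c| * (K / (2 * κ)) with hq
  have hq0 : 0 ≤ q := by positivity
  refine ⟨max D 0 * q ^ 2 / κ + K * max B 0 + |c| * q, by positivity, fun a ha hev => ?_⟩
  have hsa := hev.self_of_nhds
  obtain ⟨h1, h2, h3, h4, h5⟩ := hbd _ hsa
  have hσa := abs_sigma_le hκ hbd ha hsa (hσ a ha)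
  rw [← hq] at hσa
  -- At a passage through O, positive energy with s = σ = 0 forces s' ≠ 0. Then s'² = 2E - σ² + 2μF,
  -- with E the energy, has a derivative, and hence so does s'.
  by_cases hΓ : N.Γ (s a) = 0
  · have hs0 : s a = 0 := by
      rw [hΓ, abs_zero] at h2
      have := abs_nonneg (s a)
      exact abs_eq_zero.1 (le_antisymm (by nlinarith) this)
    refine ⟨0, by simp [hs0], ?_⟩
    have hE := hW.hasDerivAt_energy hlift ha
    have hEpos := hW.energy_pos hμ hlift hne ha
    have hσ0 : N.sigma s β a = 0 := by rw [sigma, hΓ, zero_mul]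
    have hds := (hlift a ha).1.hasDerivAt
    have hv : deriv s a ≠ 0 := by
      intro hv
      simp [hs0, hσ0, hv] at hEpos
    have hσsq : HasDerivAt (fun t => N.sigma s β t ^ 2) 0 a := by
      -- σ itself need not be known to be differentiable: σ² = O(s²), and s² vanishes to second
      -- order.
      have hs2 : HasDerivAt (fun t => s t ^ 2) 0 a := by
        refine (hds.pow 2).congr_deriv ?_
        simp [hs0]
      rw [hasDerivAt_iff_isLittleO] at hs2 ⊢
      simp only [hs0, hσ0, smul_zero, sub_zero, ne_eq, OfNat.ofNat_ne_zero, not_false_eq_true,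
        zero_pow] at hs2 ⊢
      refine IsBigO.trans_isLittleO ?_ hs2
      refine IsBigO.of_bound ((q / (a / 2)) ^ 2) ?_
      filter_upwards [hev, lt_mem_nhds (half_lt_self ha)] with t ht hta
      have ht0 : 0 < t := (half_pos ha).trans hta
      have h6 := abs_sigma_le hκ hbd ht0 ht (hσ t ht0)
      rw [← hq] at h6
      have h7 : |N.sigma s β t| ≤ q / (a / 2) * |s t| := by
        refine h6.trans ?_
        rw [div_mul_eq_mul_div]
        gcongr
      rw [norm_pow, norm_pow, Real.norm_eq_abs, Real.norm_eq_abs, ← mul_pow]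
      gcongr
    have hF : HasDerivAt (fun t => N.F (s t)) 0 a := by
      refine ((N.hasDerivAt_F (s a)).comp a hds).congr_deriv ?_
      rw [hΓ, zero_mul]
    have hg := ((hE.const_mul 2).sub hσsq).add (hF.const_mul (2 * μ))
    have h8 := hasDerivAt_deriv_of_sq
      (by filter_upwards [lt_mem_nhds ha] with t ht using (hlift t ht).1) hg
      (.of_forall fun t => by simp only [Pi.add_apply, Pi.sub_apply]; ring) hv
    refine h8.congr_deriv ?_
    rw [hΓ, hσ0]
    field_simp
    ring
  · have hs0 : s a ≠ 0 := fun h => hΓ (by rw [h, N.Γ_zero])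
    have hsp : 0 < |s a| := abs_pos.2 hs0
    refine ⟨-(N.Γ (s a) * deriv N.Γ (s a) * deriv β a ^ 2
      - N.Γ (s a) * N.slopeG k b (s a) / a ^ 2 + c / a * (N.Γ (s a) * deriv β a)), ?_,
      (hW.hasDerivAt_deriv hlift ha hΓ).congr_deriv (by ring)⟩
    have hΓp : 0 < |N.Γ (s a)| := abs_pos.2 hΓ
    have t1 : |N.Γ (s a) * deriv N.Γ (s a) * deriv β a ^ 2| ≤
        max D 0 * q ^ 2 / κ * |s a| / a ^ 2 := by
      -- The centrifugal term is Γ'σ²/Γ; two factors |s|/a from σ against one |s| from `Γ` leave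
      -- |s|/a².
      have e : N.Γ (s a) * deriv N.Γ (s a) * deriv β a ^ 2
          = deriv N.Γ (s a) * N.sigma s β a ^ 2 / N.Γ (s a) := by
        rw [sigma]; field_simp
      have hD' : |deriv N.Γ (s a)| ≤ max D 0 :=
        (hD _ (abs_le.1 hsa)).trans (le_max_left _ _)
      rw [e, abs_div, abs_mul, abs_pow]
      calc _ ≤ max D 0 * (q * |s a| / a) ^ 2 / (κ * |s a|) := by gcongr
        _ = _ := by field_simp
    have t2 : |N.Γ (s a) * N.slopeG k b (s a) / a ^ 2| ≤ K * max B 0 * |s a| / a ^ 2 := by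
      have hB' : |N.slopeG k b (s a)| ≤ max B 0 :=
        (hB _ (abs_le.1 hsa)).trans (le_max_left _ _)
      rw [abs_div, abs_mul, abs_of_pos (by positivity : 0 < a ^ 2)]
      calc _ ≤ K * |s a| * max B 0 / a ^ 2 := by gcongr
        _ = _ := by ring
    have t3 : |c / a * (N.Γ (s a) * deriv β a)| ≤ |c| * q * |s a| / a ^ 2 := by
      change |c / a * N.sigma s β a| ≤ _
      rw [abs_mul, abs_div, abs_of_pos ha]
      calc _ ≤ |c| / a * (q * |s a| / a) := by gcongr
        _ = _ := by field_simp
    rw [abs_neg]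
    refine (abs_add_le _ _).trans ((add_le_add (abs_sub _ _) le_rfl).trans ?_)
    calc _ ≤ max D 0 * q ^ 2 / κ * |s a| / a ^ 2 + K * max B 0 * |s a| / a ^ 2
          + |c| * q * |s a| / a ^ 2 := add_le_add (add_le_add t1 t2) t3
      _ = _ := by ring

end RevolutionSurface

/-! ### Decay of the damped pendulum -/

namespace RevolutionSurface

/-- Cubic Taylor bounds for `Γ` and the corresponding bound for `F`. -/
theorem exists_cubic_bounds (N : RevolutionSurface) (R : ℝ) :
    ∃ T, 0 ≤ T ∧ ∀ s, |s| ≤ R →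
      |N.Γ s - s - iteratedDeriv 3 N.Γ 0 / 6 * s ^ 3| ≤ T * |s| ^ 5 ∧
      |N.Γ s - s| ≤ T * |s| ^ 3 ∧ |N.F s - s ^ 2 / 2| ≤ T * s ^ 4 := by
  obtain ⟨C, hC0, hC⟩ := exists_abs_sub_cubic_le N.smooth N.odd R
  simp only [N.deriv_Γ_zero, one_mul] at hC
  set γ := iteratedDeriv 3 N.Γ 0
  set T := C + (|γ| / 6 + C * R ^ 2)
  have hT0 : 0 ≤ T := by positivity
  have h3 : ∀ s, |s| ≤ R → |N.Γ s - s| ≤ T * |s| ^ 3 := by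
    intro s hs
    have h := hC s hs
    have e : N.Γ s - s = (N.Γ s - s - γ / 6 * s ^ 3) + γ / 6 * s ^ 3 := by ring
    rw [e]
    refine (abs_add_le _ _).trans ?_
    rw [abs_mul, abs_div, abs_pow, abs_of_pos (by norm_num : (0 : ℝ) < 6)]
    have h5 : C * |s| ^ 5 ≤ C * R ^ 2 * |s| ^ 3 := by
      have : |s| ^ 5 = |s| ^ 2 * |s| ^ 3 := by ring
      rw [this, ← mul_assoc]
      gcongr
    have h6 : 0 ≤ C * |s| ^ 3 := by positivity
    calc _ ≤ C * R ^ 2 * |s| ^ 3 + |γ| / 6 * |s| ^ 3 := by linarith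
      _ ≤ C * R ^ 2 * |s| ^ 3 + |γ| / 6 * |s| ^ 3 + C * |s| ^ 3 := by linarith
      _ = _ := by ring
  refine ⟨T, hT0, fun s hs => ⟨(hC s hs).trans ?_, h3 s hs, ?_⟩⟩
  · have : 0 ≤ |γ| / 6 + C * R ^ 2 := by positivity
    gcongr
    exact le_add_of_nonneg_right this
  · have hd : ∀ x : ℝ, HasDerivAt (fun x => N.F x - x ^ 2 / 2) (N.Γ x - x) x := by
      intro x
      refine ((N.hasDerivAt_F x).sub ((hasDerivAt_pow 2 x).div_const 2)).congr_deriv ?_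
      push_cast; ring
    have hb : ∀ x : ℝ, HasDerivAt (fun x => T * x ^ 4) (4 * T * x ^ 3) x := by
      intro x
      refine ((hasDerivAt_pow 4 x).const_mul T).congr_deriv ?_
      push_cast; ring
    have := image_norm_le_of_norm_deriv_right_le_deriv_boundary (a := 0) (b := |s|)
      (f := fun x => N.F x - x ^ 2 / 2) (fun x _ => (hd x).continuousAt.continuousWithinAt)
      (fun x _ => (hd x).hasDerivWithinAt) (by simp) hb (fun x hx => ?_)
      ⟨abs_nonneg s, le_rfl⟩
    · simpa [N.F_abs, Even.pow_abs (show Even 4 by decide)] using this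
    · have hx0 : |x| = x := abs_of_nonneg hx.1
      have := h3 x (by rw [hx0]; exact hx.2.le.trans hs)
      rw [hx0] at this
      rw [Real.norm_eq_abs]
      have : 0 ≤ T * x ^ 3 := mul_nonneg hT0 (pow_nonneg hx.1 3)
      linarith

end RevolutionSurface

/-- A solution `(s, v)` of a damped pendulum equation `s'' + s'/a + m² Γ(s) = O(|s| / a²)` for
`a > a₁`, with `F` the primitive of `Γ` and the bounds on them that are used below. -/
structure DampedPendulum (Γ F s v : ℝ → ℝ) (m γ κ K T C R a₁ : ℝ) : Prop where
  m_pos : 0 < m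
  κ_pos : 0 < κ
  κ_le : κ ≤ K
  T_nonneg : 0 ≤ T
  C_nonneg : 0 ≤ C
  one_le : 1 ≤ a₁
  hasDerivAt_F : ∀ x, HasDerivAt F (Γ x) x
  le_mul_Γ : ∀ x, |x| ≤ R → κ * x ^ 2 ≤ x * Γ x
  le_F : ∀ x, |x| ≤ R → κ / 2 * x ^ 2 ≤ F x
  F_le : ∀ x, |x| ≤ R → F x ≤ K / 2 * x ^ 2
  abs_cubic_le : ∀ x, |x| ≤ R → |Γ x - x - γ / 6 * x ^ 3| ≤ T * |x| ^ 5
  abs_linear_le : ∀ x, |x| ≤ R → |Γ x - x| ≤ T * |x| ^ 3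
  abs_F_le : ∀ x, |x| ≤ R → |F x - x ^ 2 / 2| ≤ T * x ^ 4
  abs_le : ∀ a, a₁ < a → |s a| ≤ R
  pos : ∀ a, a₁ < a → 0 < s a ^ 2 + v a ^ 2
  hasDerivAt_s : ∀ a, a₁ < a → HasDerivAt s (v a) a
  hasDerivAt_v : ∀ a, a₁ < a → ∃ e, |e| ≤ C * |s a| / a ^ 2 ∧
    HasDerivAt v (-(v a / a) - m ^ 2 * Γ (s a) - e) a

namespace DampedPendulum

variable {Γ F s v : ℝ → ℝ} {m γ κ K T C R a₁ : ℝ}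

/-- The energy, scaled by `a` and corrected so that its derivative is of higher order. -/
def energy (F s v : ℝ → ℝ) (m a : ℝ) : ℝ :=
  a * (v a ^ 2 / 2 + m ^ 2 * F (s a)) + s a * v a / 2

/-- Scaling by a turns the damping into a net -v²/2, which the derivative of the correction s v/2
cancels. What remains is F - sΓ/2, quartic in s, and errors quadratic in (s, v) divided by a. -/
theorem exists_hasDerivAt_energy (h : DampedPendulum Γ F s v m γ κ K T C R a₁) {a : ℝ}
    (ha : a₁ < a) : ∃ d, HasDerivAt (energy F s v m)
        (m ^ 2 * (F (s a) - s a * Γ (s a) / 2) + d) a ∧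
      |d| ≤ (C + 1 / 4) * (s a ^ 2 + v a ^ 2) / a := by
  have ha1 : 1 ≤ a := h.one_le.trans ha.le
  have ha0 : 0 < a := by linarith
  obtain ⟨e, he, hv⟩ := h.hasDerivAt_v a ha
  have hs := h.hasDerivAt_s a ha
  have hF := (h.hasDerivAt_F (s a)).comp a hs
  have hQ := ((hasDerivAt_id a).mul (((hv.pow 2).div_const 2).add (hF.const_mul (m ^ 2)))).add
    ((hs.mul hv).div_const 2)
  refine ⟨-(a * e * v a) - s a * v a / (2 * a) - s a * e / 2, hQ.congr_deriv ?_, ?_⟩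
  · simp only [id, Pi.add_apply, Function.comp_apply, Pi.pow_apply]
    push_cast
    field_simp
    ring
  · have hsv : |s a| * |v a| ≤ (s a ^ 2 + v a ^ 2) / 2 := by
      rw [← sq_abs (s a), ← sq_abs (v a)]
      nlinarith [sq_nonneg (|s a| - |v a|)]
    have hC := h.C_nonneg
    have t1 : |-(a * e * v a)| ≤ C * ((s a ^ 2 + v a ^ 2) / 2) / a := by
      rw [abs_neg, abs_mul, abs_mul, abs_of_pos ha0]
      calc _ ≤ a * (C * |s a| / a ^ 2) * |v a| := by gcongr
        _ = C * (|s a| * |v a|) / a := by field_simp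
        _ ≤ _ := by gcongr
    have t2 : |s a * v a / (2 * a)| ≤ (s a ^ 2 + v a ^ 2) / 2 / (2 * a) := by
      rw [abs_div, abs_mul, abs_of_pos (by positivity : 0 < 2 * a)]
      gcongr
    have t3 : |s a * e / 2| ≤ C * ((s a ^ 2 + v a ^ 2) / 2) / a := by
      rw [abs_div, abs_mul, abs_of_pos (by norm_num : (0 : ℝ) < 2)]
      calc _ ≤ |s a| * (C * |s a| / a ^ 2) / 2 := by gcongr
        _ = C * (s a ^ 2 / 2) / (a * a) := by rw [← sq_abs (s a)]; field_simp
        _ ≤ C * ((s a ^ 2 + v a ^ 2) / 2) / (a * 1) := by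
          gcongr
          nlinarith [sq_nonneg (v a)]
        _ = _ := by rw [mul_one]
    refine (abs_sub _ _).trans ((add_le_add (abs_sub _ _) le_rfl).trans ?_)
    calc _ ≤ C * ((s a ^ 2 + v a ^ 2) / 2) / a + (s a ^ 2 + v a ^ 2) / 2 / (2 * a)
          + C * ((s a ^ 2 + v a ^ 2) / 2) / a := add_le_add (add_le_add t1 t2) t3
      _ = _ := by field_simp; ring

/-- The solution has size exactly `a^{-1/2}`. -/
theorem exists_decay (h : DampedPendulum Γ F s v m γ κ K T C R a₁) :
    ∃ a₂ c₁ c₂, a₁ ≤ a₂ ∧ 0 < c₁ ∧ ∀ a, a₂ ≤ a →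
      c₁ ≤ a * (s a ^ 2 + v a ^ 2) ∧ a * (s a ^ 2 + v a ^ 2) ≤ c₂ := by
  have hm := h.m_pos
  have hκ := h.κ_pos
  have hK : 0 < K := hκ.trans_le h.κ_le
  have hT := h.T_nonneg
  have hC := h.C_nonneg
  obtain ⟨l, hl0, hl1, hl2⟩ : ∃ l, 0 < l ∧ l ≤ 1 / 2 ∧ l ≤ m ^ 2 * κ / 2 :=
    ⟨min (1 / 2) (m ^ 2 * κ / 2), by positivity, min_le_left _ _, min_le_right _ _⟩
  set L := 3 / 4 + m ^ 2 * K / 2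
  have hL : 0 < L := by positivity
  -- The energy density is at least l q with q = s² + v², and |s v|/2 ≤ q/4; from a = 1/(2l) on, the
  -- correction costs at most half of a l q.
  set b := max (a₁ + 1) (1 / (2 * l))
  have hb1 : a₁ < b := lt_of_lt_of_le (by linarith) (le_max_left _ _)
  have hb1' : 1 ≤ b := h.one_le.trans hb1.le
  set Q := energy F s v m with hQdef
  set q : ℝ → ℝ := fun a => s a ^ 2 + v a ^ 2 with hqdef
  have hgt : ∀ a, b ≤ a → a₁ < a := fun a ha => hb1.trans_le ha
  have hone : ∀ a, b ≤ a → 1 ≤ a := fun a ha => hb1'.trans ha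
  have hsv : ∀ a, |s a * v a| ≤ q a / 2 := by
    intro a
    rw [_root_.abs_le]
    constructor <;> simp only [hqdef] <;> nlinarith [sq_nonneg (s a - v a), sq_nonneg (s a + v a)]
  have hQlow : ∀ a, b ≤ a → l / 2 * (a * q a) ≤ Q a := by
    intro a ha
    have ha0 := hone a ha
    have h1 := h.le_F _ (h.abs_le a (hgt a ha))
    have h2 := neg_abs_le (s a * v a)
    have h3 := hsv a
    have h4 : 1 / 2 ≤ l * a := by
      have : 1 / (2 * l) ≤ a := (le_max_right _ _).trans ha
      rw [div_le_iff₀ (by positivity)] at this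
      linarith
    have h5 : l * q a ≤ v a ^ 2 / 2 + m ^ 2 * F (s a) := by
      have i1 : m ^ 2 * (κ / 2 * s a ^ 2) ≤ m ^ 2 * F (s a) := by gcongr
      have i2 := mul_le_mul_of_nonneg_right hl2 (sq_nonneg (s a))
      have i3 := mul_le_mul_of_nonneg_right hl1 (sq_nonneg (v a))
      simp only [hqdef]
      linarith
    have h6 : a * (l * q a) ≤ a * (v a ^ 2 / 2 + m ^ 2 * F (s a)) := by gcongr
    have h7 : 0 < q a := h.pos a (hgt a ha)
    have h8 := mul_le_mul_of_nonneg_right h4 h7.le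
    simp only [hQdef, energy]
    linarith
  have hQup : ∀ a, b ≤ a → Q a ≤ L * (a * q a) := by
    intro a ha
    have ha0 := hone a ha
    have h1 := h.F_le _ (h.abs_le a (hgt a ha))
    have h2 := le_abs_self (s a * v a)
    have h3 := hsv a
    have h7 : 0 < q a := h.pos a (hgt a ha)
    have i1 : a * (v a ^ 2 / 2 + m ^ 2 * F (s a)) ≤ a * (v a ^ 2 / 2 + m ^ 2 * (K / 2 * s a ^ 2)) := by
      gcongr
    have i2 : v a ^ 2 / 2 + m ^ 2 * (K / 2 * s a ^ 2) ≤ (1 / 2 + m ^ 2 * K / 2) * q a := by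
      simp only [hqdef]
      have : 0 ≤ m ^ 2 * K / 2 * v a ^ 2 := by positivity
      nlinarith [sq_nonneg (s a)]
    have i3 : a * (v a ^ 2 / 2 + m ^ 2 * (K / 2 * s a ^ 2)) ≤
      a * ((1 / 2 + m ^ 2 * K / 2) * q a) := by gcongr
    have i4 : q a ≤ a * q a := le_mul_of_one_le_left h7.le ha0
    simp only [hQdef, energy, L]
    linarith
  have hQpos : ∀ a, b ≤ a → 0 < Q a := fun a ha =>
    lt_of_lt_of_le (by have := h.pos a (hgt a ha); have := hone a ha; positivity) (hQlow a ha)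
  have hqle : ∀ a, b ≤ a → q a ≤ 2 / l * (Q a / a) := by
    intro a ha
    have ha0 : 0 < a := by linarith [hone a ha]
    have := hQlow a ha
    rw [div_mul_div_comm, le_div_iff₀ (by positivity)]
    linarith
  choose! Q' hQ' using fun a (ha : b ≤ a) => h.exists_hasDerivAt_energy (hgt a ha)
  set C₁ := (C + 1 / 4) * (2 / l) with hC₁
  have hC₁0 : 0 ≤ C₁ := by positivity
  have hd : ∀ a, b ≤ a → |Q' a| ≤ C₁ * (Q a / a ^ 2) := by
    intro a ha
    have ha0 : 0 < a := by linarith [hone a ha]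
    refine (hQ' a ha).2.trans ?_
    calc _ ≤ (C + 1 / 4) * (2 / l * (Q a / a)) / a := by
          have := hqle a ha
          simp only [hqdef] at this
          gcongr
      _ = _ := by rw [hC₁]; field_simp
  -- Since sΓ/2 ≥ δF, the leading term is at most (1 - δ)m²F. So Q grows at most like a^{1-δ}, and q
  -- decays like a^{-δ}.
  set δ := κ / K with hδ
  have hδ0 : 0 < δ := by positivity
  have hδ1 : δ ≤ 1 := (div_le_one hK).2 h.κ_le
  have hcv : Convex ℝ (Set.Ici b) := convex_Ici b
  -- first decay estimate
  set C₂ := C₁ + 1 / (2 * l) with hC₂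
  have hrough : ∀ a, b ≤ a → m ^ 2 * (F (s a) - s a * Γ (s a) / 2) + Q' a ≤
      ((1 - δ) / a + C₂ / a ^ 2) * Q a := by
    intro a ha
    have ha0 : 0 < a := by linarith [hone a ha]
    have h1 := h.le_mul_Γ _ (h.abs_le a (hgt a ha))
    have h2 := h.F_le _ (h.abs_le a (hgt a ha))
    have h3 : δ * F (s a) ≤ s a * Γ (s a) / 2 := by
      have : δ * F (s a) ≤ δ * (K / 2 * s a ^ 2) := by gcongr
      have e : δ * (K / 2 * s a ^ 2) = κ * s a ^ 2 / 2 := by rw [hδ]; field_simp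
      linarith
    have h4 : m ^ 2 * (F (s a) - s a * Γ (s a) / 2) ≤ (1 - δ) * (m ^ 2 * F (s a)) := by
      have : m ^ 2 * (δ * F (s a)) ≤ m ^ 2 * (s a * Γ (s a) / 2) := by gcongr
      linarith
    have h5 : m ^ 2 * F (s a) ≤ Q a / a + 1 / (2 * l) * (Q a / a ^ 2) := by
      have e : Q a / a = v a ^ 2 / 2 + m ^ 2 * F (s a) + s a * v a / (2 * a) := by
        simp only [hQdef, energy]; field_simp
      have i1 : |s a * v a / (2 * a)| ≤ 1 / (2 * l) * (Q a / a ^ 2) := by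
        rw [abs_div, abs_of_pos (by positivity : 0 < 2 * a)]
        calc _ ≤ (2 / l * (Q a / a)) / 2 / (2 * a) := by
              have := (hsv a).trans (div_le_div_of_nonneg_right (hqle a ha) zero_le_two)
              gcongr
          _ = _ := by field_simp
      have i2 := neg_abs_le (s a * v a / (2 * a))
      nlinarith [sq_nonneg (v a)]
    have h6 : (1 - δ) * (m ^ 2 * F (s a)) ≤
        (1 - δ) * (Q a / a + 1 / (2 * l) * (Q a / a ^ 2)) := by
      have : 0 ≤ 1 - δ := by linarith
      gcongr
    have h7 := (le_abs_self _).trans (hd a ha)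
    have h8 : 0 ≤ δ * (1 / (2 * l) * (Q a / a ^ 2)) := by
      have := hQpos a ha
      positivity
    have e : ((1 - δ) / a + C₂ / a ^ 2) * Q a = (1 - δ) * (Q a / a) + C₁ * (Q a / a ^ 2)
        + 1 / (2 * l) * (Q a / a ^ 2) := by rw [hC₂]; ring
    linarith
  have hψ : ∀ a ∈ Set.Ici b, HasDerivAt (fun a => (1 - δ) * Real.log a - C₂ / a)
      ((1 - δ) / a + C₂ / a ^ 2) a := by
    intro a ha
    have ha0 : a ≠ 0 := by linarith [hone a ha]
    refine (((Real.hasDerivAt_log ha0).const_mul (1 - δ)).sub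
      ((hasDerivAt_inv ha0).const_mul C₂)).congr_deriv ?_
    field_simp
    ring
  have hanti := antitoneOn_mul_exp_neg hcv (fun a ha => (hQ' a ha).1) hψ hrough
  obtain ⟨M, hM0, hM⟩ : ∃ M, 0 ≤ M ∧ ∀ a, b ≤ a → q a ≤ M * a ^ (-δ) := by
    set ψ := fun a => (1 - δ) * Real.log a - C₂ / a
    have hQb := hQpos b le_rfl
    refine ⟨2 / l * (Q b * Real.exp (-ψ b)), by positivity, fun a ha => ?_⟩
    have ha0 : 0 < a := by linarith [hone a ha]
    have h1 : Q a * Real.exp (-ψ a) ≤ Q b * Real.exp (-ψ b) := hanti Set.self_mem_Ici ha ha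
    have h2 : Q a ≤ Q b * Real.exp (-ψ b) * Real.exp (ψ a) := by
      have := mul_le_mul_of_nonneg_right h1 (Real.exp_pos (ψ a)).le
      rwa [mul_assoc (Q a), ← Real.exp_add, neg_add_cancel, Real.exp_zero, mul_one] at this
    have h3 : Real.exp (ψ a) ≤ a * a ^ (-δ) := by
      have e : a * a ^ (-δ) = Real.exp ((1 - δ) * Real.log a) := by
        rw [Real.rpow_def_of_pos ha0]
        nth_rewrite 1 [← Real.exp_log ha0]
        rw [← Real.exp_add]
        congr 1; ring
      rw [e]
      apply Real.exp_le_exp.2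
      have : 0 ≤ C₂ / a := by positivity
      simp only [ψ]
      linarith
    refine (hqle a ha).trans ?_
    rw [mul_assoc (2 / l)]
    gcongr
    rw [div_le_iff₀ ha0]
    calc Q a ≤ Q b * Real.exp (-ψ b) * Real.exp (ψ a) := h2
      _ ≤ Q b * Real.exp (-ψ b) * (a * a ^ (-δ)) := by gcongr
      _ = _ := by ring
  -- the scaled energy is bounded above and below
  set C₃ := m ^ 2 * (3 / 2 * T * (2 / l * M)) + C₁ with hC₃
  have hC₃0 : 0 ≤ C₃ := by positivity
  -- In s⁴ = s² · s² one factor is bounded by the rough decay and the other by Q/a, which makes the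
  -- logarithmic derivative of Q integrable.
  have hfine : ∀ a, b ≤ a → |m ^ 2 * (F (s a) - s a * Γ (s a) / 2) + Q' a| ≤
      C₃ * a ^ (-δ - 1) * Q a := by
    intro a ha
    have ha0 : 0 < a := by linarith [hone a ha]
    have hR := h.abs_le a (hgt a ha)
    have h1 : |F (s a) - s a * Γ (s a) / 2| ≤ 3 / 2 * T * s a ^ 4 := by
      have i1 := h.abs_F_le _ hR
      have i2 := h.abs_linear_le _ hR
      have e : F (s a) - s a * Γ (s a) / 2 = (F (s a) - s a ^ 2 / 2) - s a * (Γ (s a) - s a) / 2 := by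
        ring
      have i3 : |s a * (Γ (s a) - s a) / 2| ≤ T * s a ^ 4 / 2 := by
        rw [abs_div, abs_mul, abs_of_pos (by norm_num : (0 : ℝ) < 2)]
        have : |s a| * |Γ (s a) - s a| ≤ |s a| * (T * |s a| ^ 3) := by gcongr
        have e : |s a| * (T * |s a| ^ 3) = T * s a ^ 4 := by
          rw [← Even.pow_abs (show Even 4 by decide) (s a)]; ring
        linarith
      rw [e]
      refine (abs_sub _ _).trans ?_
      linarith
    have h2 : s a ^ 4 ≤ 2 / l * M * a ^ (-δ - 1) * Q a := by
      have i1 : s a ^ 2 ≤ q a := by simp only [hqdef]; nlinarith [sq_nonneg (v a)]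
      have i2 := i1.trans (hM a ha)
      have i3 := i1.trans (hqle a ha)
      have hq0 := hQpos a ha
      calc s a ^ 4 = s a ^ 2 * s a ^ 2 := by ring
        _ ≤ M * a ^ (-δ) * (2 / l * (Q a / a)) := by gcongr
        _ = _ := by rw [Real.rpow_sub_one ha0.ne']; field_simp
    have h3 : 1 / a ^ 2 ≤ a ^ (-δ - 1) := by
      rw [one_div, ← Real.rpow_natCast, ← Real.rpow_neg ha0.le]
      apply Real.rpow_le_rpow_of_exponent_le (hone a ha)
      push_cast
      linarith
    have hq0 := hQpos a ha
    refine (abs_add_le _ _).trans ?_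
    rw [abs_mul, abs_of_nonneg (sq_nonneg m)]
    calc _ ≤ m ^ 2 * (3 / 2 * T * (2 / l * M * a ^ (-δ - 1) * Q a)) + C₁ * (Q a / a ^ 2) := by
          have := hd a ha
          gcongr
          exact h1.trans (by gcongr)
      _ = m ^ 2 * (3 / 2 * T * (2 / l * M)) * a ^ (-δ - 1) * Q a + C₁ * (1 / a ^ 2) * Q a := by ring
      _ ≤ m ^ 2 * (3 / 2 * T * (2 / l * M)) * a ^ (-δ - 1) * Q a + C₁ * a ^ (-δ - 1) * Q a := by
          gcongr
      _ = _ := by rw [hC₃]; ring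
  -- This primitive is bounded on [b, ∞), so Grönwall for Q and for -Q confines Q between positive
  -- constants.
  set φ := fun a : ℝ => -(C₃ / δ) * a ^ (-δ) with hφdef
  have hφ : ∀ a ∈ Set.Ici b, HasDerivAt φ (C₃ * a ^ (-δ - 1)) a := by
    intro a ha
    have ha0 : a ≠ 0 := by linarith [hone a ha]
    refine ((Real.hasDerivAt_rpow_const (p := -δ) (Or.inl ha0)).const_mul _).congr_deriv ?_
    field_simp
  have hφ0 : ∀ a, b ≤ a → φ a ≤ 0 := by
    intro a ha
    have ha0 : 0 < a := by linarith [hone a ha]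
    have : 0 ≤ C₃ / δ * a ^ (-δ) := by positivity
    simp only [hφdef]
    linarith
  have hup := antitoneOn_mul_exp_neg hcv (fun a ha => (hQ' a ha).1) hφ
    (fun a ha => (le_abs_self _).trans (hfine a ha))
  have hlow := antitoneOn_mul_exp_neg hcv (fun a ha => (hQ' a ha).1.neg) (fun a ha => (hφ a ha).neg)
    (fun a ha => by
      have := (neg_le_abs _).trans (hfine a ha)
      simpa using this)
  refine ⟨b, Q b * Real.exp (φ b) / L, 2 / l * (Q b * Real.exp (-φ b)), hb1.le,
    by have := hQpos b le_rfl; positivity, fun a ha => ?_⟩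
  have ha0 : 0 < a := by linarith [hone a ha]
  have hQa := hQpos a ha
  have h1 : Q a * Real.exp (-φ a) ≤ Q b * Real.exp (-φ b) := hup Set.self_mem_Ici ha ha
  have h2 : -Q a * Real.exp (-(-φ a)) ≤ -Q b * Real.exp (-(-φ b)) :=
    hlow Set.self_mem_Ici ha ha
  rw [neg_neg, neg_neg] at h2
  have h3 : 1 ≤ Real.exp (-φ a) := Real.one_le_exp (by linarith [hφ0 a ha])
  have h4 : Real.exp (φ a) ≤ 1 := Real.exp_le_one_iff.2 (hφ0 a ha)
  constructor
  · rw [div_le_iff₀ hL]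
    have := hQup a ha
    have : Q a * Real.exp (φ a) ≤ Q a * 1 := by gcongr
    simp only [hqdef] at *
    linarith
  · have := hqle a ha
    have i1 : Q a ≤ Q b * Real.exp (-φ b) := by
      refine le_trans ?_ h1
      exact le_mul_of_one_le_right hQa.le h3
    calc a * (s a ^ 2 + v a ^ 2) ≤ a * (2 / l * (Q a / a)) := by gcongr
      _ = 2 / l * Q a := by field_simp
      _ ≤ _ := by gcongr

end DampedPendulum

/-! ### Normal form and asymptotics of the phase -/

/-- A function whose derivative is `O(a⁻²)` converges at rate `O(a⁻¹)`. -/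
theorem exists_limit_of_deriv_isBigO {E : Type*} [NormedAddCommGroup E] [NormedSpace ℝ E]
    [CompleteSpace E] {f f' : ℝ → E} (hf : ∀ᶠ a in atTop, HasDerivAt f (f' a) a)
    (hf' : f' =O[atTop] fun a : ℝ => a⁻¹ ^ 2) :
    ∃ l, (fun a => f a - l) =O[atTop] fun a : ℝ => a⁻¹ := by
  obtain ⟨C, hC, hb⟩ := hf'.exists_pos
  rw [isBigOWith_iff] at hb
  obtain ⟨A, hA⟩ := eventually_atTop.1 (hf.and (hb.and (eventually_ge_atTop (1 : ℝ))))
  have hdist : ∀ a, A ≤ a → ∀ x, a ≤ x → ‖f x - f a‖ ≤ C * (a⁻¹ - x⁻¹) := by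
    intro a ha x hx
    have hpos : ∀ t, a ≤ t → 0 < t := fun t ht => by linarith [(hA t (ha.trans ht)).2.2]
    have hB : ∀ t, a ≤ t → HasDerivAt (fun t => C * (a⁻¹ - t⁻¹)) (C * t⁻¹ ^ 2) t := by
      intro t ht
      refine (((hasDerivAt_inv (hpos t ht).ne').const_sub a⁻¹).const_mul C).congr_deriv ?_
      field_simp
    refine image_norm_le_of_norm_deriv_right_le_deriv_boundary' (a := a) (b := x)
      (f := fun t => f t - f a) (f' := f')
      (fun t ht => ((hA t (ha.trans ht.1)).1.sub_const _).continuousAt.continuousWithinAt)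
      (fun t ht => ((hA t (ha.trans ht.1)).1.sub_const _).hasDerivWithinAt)
      (by simp) (fun t ht => (hB t ht.1).continuousAt.continuousWithinAt)
      (fun t ht => (hB t ht.1).hasDerivWithinAt) (fun t ht => ?_) ⟨hx, le_rfl⟩
    have := (hA t (ha.trans ht.1)).2.1
    simpa using this
  have hcau : CauchySeq f := by
    refine Metric.cauchySeq_iff'.2 fun ε hε => ⟨max A (C / ε + 1), fun x hx => ?_⟩
    have hN : 0 < max A (C / ε + 1) := lt_of_lt_of_le (by positivity) (le_max_right _ _)
    have hx0 : 0 < x := hN.trans_le hx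
    rw [dist_eq_norm]
    refine (hdist _ (le_max_left _ _) x hx).trans_lt ?_
    have h1 : C < ε * max A (C / ε + 1) := by
      have : C / ε < max A (C / ε + 1) := lt_of_lt_of_le (by linarith) (le_max_right _ _)
      rwa [div_lt_iff₀' hε] at this
    have h2 : C * (max A (C / ε + 1))⁻¹ < ε := by
      rwa [← div_eq_mul_inv, div_lt_iff₀ hN]
    have h3 : 0 ≤ C * x⁻¹ := by positivity
    rw [mul_sub]
    linarith
  obtain ⟨l, hl⟩ := cauchySeq_tendsto_of_complete hcau
  refine ⟨l, IsBigO.of_bound C ?_⟩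
  filter_upwards [eventually_ge_atTop A, eventually_gt_atTop 0] with a ha ha0
  have h1 : Tendsto (fun x => ‖f x - f a‖) atTop (𝓝 ‖l - f a‖) := (hl.sub_const _).norm
  rw [← norm_neg, neg_sub]
  refine le_of_tendsto h1 ?_
  filter_upwards [eventually_ge_atTop a] with x hx
  refine (hdist a ha x hx).trans ?_
  have hx0 : 0 < x := ha0.trans_le hx
  rw [Real.norm_of_nonneg (by positivity)]
  have : 0 ≤ x⁻¹ := by positivity
  gcongr
  linarith

theorem isBigO_inv_sq_inv : (fun a : ℝ => a⁻¹ ^ 2) =O[atTop] fun a : ℝ => a⁻¹ := by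
  refine IsBigO.of_bound 1 ?_
  filter_upwards [eventually_ge_atTop 1] with a ha
  have : a⁻¹ ≤ 1 := inv_le_one_of_one_le₀ ha
  have h0 : 0 ≤ a⁻¹ := by positivity
  rw [Real.norm_of_nonneg (by positivity), Real.norm_of_nonneg h0]
  nlinarith

theorem isBigO_inv_one : (fun a : ℝ => a⁻¹) =O[atTop] fun _ : ℝ => (1 : ℝ) :=
  tendsto_inv_atTop_zero.isBigO_one ℝ

section

variable {ζ ρ : ℝ → ℂ} {m γ : ℝ}

/-- The correction removing the nonresonant terms at order `a⁻¹`. -/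
def resonantCorrection (m γ : ℝ) (z : ℂ) : ℂ :=
  Complex.I / (4 * m) * starRingEnd ℂ z + (γ / (96 * m ^ 2) : ℝ) *
    (-z ^ 3 + 3 * z * starRingEnd ℂ z ^ 2 + starRingEnd ℂ z ^ 3 / 2)

/-- Near-identity transformation to a rotation with amplitude-dependent frequency. -/
theorem exists_near_identity (hm : 0 < m)
    (hζ : ∀ᶠ a in atTop, HasDerivAt ζ (-(Complex.I * m * ζ a) + (a⁻¹ : ℝ) *
      (starRingEnd ℂ (ζ a) / 2 - Complex.I * γ / (6 * m) * ((ζ a).re : ℂ) ^ 3) + ρ a) a)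
    (hρ : ρ =O[atTop] fun a : ℝ => a⁻¹ ^ 2) (hb : ζ =O[atTop] fun _ => (1 : ℝ)) :
    ∃ Z r : ℝ → ℂ, (fun a => Z a - ζ a) =O[atTop] (fun a : ℝ => a⁻¹) ∧
      r =O[atTop] (fun a : ℝ => a⁻¹ ^ 2) ∧
      ∀ᶠ a in atTop, HasDerivAt Z
        (-(Complex.I * (m + γ / (16 * m) * ‖ζ a‖ ^ 2 * a⁻¹ : ℝ)) * Z a + r a) a := by
  set n : ℝ → ℂ := fun a => starRingEnd ℂ (ζ a) / 2 - Complex.I * γ / (6 * m) * ((ζ a).re : ℂ) ^ 3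
    with hn
  set η : ℝ → ℂ := fun a => (a⁻¹ : ℝ) * n a + ρ a with hη
  have hcb : (fun a => starRingEnd ℂ (ζ a)) =O[atTop] fun _ => (1 : ℝ) :=
    (IsBigO.of_bound 1 (.of_forall fun a => by simp)).trans hb
  have hreb : (fun a => ((ζ a).re : ℂ)) =O[atTop] fun _ => (1 : ℝ) :=
    (IsBigO.of_bound 1 (.of_forall fun a => by
      simpa using Complex.abs_re_le_norm (ζ a))).trans hb
  have one_mul_big : ∀ {f g : ℝ → ℂ}, f =O[atTop] (fun _ => (1 : ℝ)) →
      g =O[atTop] (fun _ => (1 : ℝ)) → (fun a => f a * g a) =O[atTop] (fun _ => (1 : ℝ)) :=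
    fun hf hg => by simpa using hf.mul hg
  have pow_big : ∀ {f : ℝ → ℂ} (k : ℕ), f =O[atTop] (fun _ => (1 : ℝ)) →
      (fun a => f a ^ k) =O[atTop] (fun _ => (1 : ℝ)) := fun k hf => by simpa using hf.pow k
  have hnb : n =O[atTop] fun _ => (1 : ℝ) := by
    have h1 := hcb.const_mul_left (1 / 2 : ℂ)
    have h2 := (pow_big 3 hreb).const_mul_left (Complex.I * γ / (6 * m))
    refine (h1.sub h2).congr_left fun a => ?_
    simp only [hn]; ring
  have hinv : (fun a : ℝ => ((a⁻¹ : ℝ) : ℂ)) =O[atTop] fun a : ℝ => a⁻¹ :=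
    IsBigO.of_bound 1 (.of_forall fun a => by simp)
  have hηb : η =O[atTop] fun a : ℝ => a⁻¹ := by
    have := hinv.mul hnb
    simp only [mul_one] at this
    exact this.add (hρ.trans isBigO_inv_sq_inv)
  have hηcb : (fun a => starRingEnd ℂ (η a)) =O[atTop] fun a : ℝ => a⁻¹ :=
    (IsBigO.of_bound 1 (.of_forall fun a => by simp)).trans hηb
  -- A monomial c z^j z̄^k at order a⁻¹ is removed by the coefficient ic/(m(1 - j + k)) in P. Only
  -- z²z̄ has denominator zero; it stays as the frequency shift.
  set P : ℝ → ℂ := fun a => resonantCorrection m γ (ζ a) with hP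
  have hPb : P =O[atTop] fun _ => (1 : ℝ) := by
    have h1 := hcb.const_mul_left (Complex.I / (4 * m))
    have h2 := (((pow_big 3 hb).neg_left.add
      ((one_mul_big hb (pow_big 2 hcb)).const_mul_left 3)).add
      ((pow_big 3 hcb).const_mul_left (1 / 2))).const_mul_left ((γ / (96 * m ^ 2) : ℝ) : ℂ)
    refine (h1.add h2).congr_left fun a => ?_
    simp only [hP, resonantCorrection]; ring
  -- the part of the derivative of the correction coming from `η`
  set rest : ℝ → ℂ := fun a => Complex.I / (4 * m) * starRingEnd ℂ (η a) +
    (γ / (96 * m ^ 2) : ℝ) * (-3 * (ζ a ^ 2 * η a) + 3 * (starRingEnd ℂ (ζ a) ^ 2 * η a)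
      + 6 * (ζ a * starRingEnd ℂ (ζ a) * starRingEnd ℂ (η a))
      + 3 / 2 * (starRingEnd ℂ (ζ a) ^ 2 * starRingEnd ℂ (η a))) with hrest
  have mul_big : ∀ {f g : ℝ → ℂ}, f =O[atTop] (fun _ => (1 : ℝ)) →
      g =O[atTop] (fun a : ℝ => a⁻¹) → (fun a => f a * g a) =O[atTop] (fun a : ℝ => a⁻¹) :=
    fun hf hg => by simpa using hf.mul hg
  have hrestb : rest =O[atTop] fun a : ℝ => a⁻¹ :=
    (hηcb.const_mul_left _).add
      ((((((mul_big (pow_big 2 hb) hηb).const_mul_left _).add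
        ((mul_big (pow_big 2 hcb) hηb).const_mul_left _)).add
        ((mul_big (one_mul_big hb hcb) hηcb).const_mul_left _)).add
        ((mul_big (pow_big 2 hcb) hηcb).const_mul_left _)).const_mul_left _)
  have hnorm : (fun a => ((‖ζ a‖ ^ 2 : ℝ) : ℂ)) =O[atTop] fun _ => (1 : ℝ) := by
    have := hb.norm_left.pow 2
    simp only [one_pow] at this
    exact (IsBigO.of_bound 1 (.of_forall fun a => by simp)).trans this
  have hinv2 : (fun a : ℝ => (((a⁻¹ : ℝ) : ℂ)) ^ 2) =O[atTop] fun a : ℝ => a⁻¹ ^ 2 := hinv.pow 2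
  -- The a⁻² P term comes from differentiating a⁻¹; the last term arises because the shifted
  -- frequency multiplies Z instead of ζ.
  set r : ℝ → ℂ := fun a => ρ a + (a⁻¹ : ℝ) * rest a - ((a⁻¹ : ℝ) : ℂ) ^ 2 * P a
    + Complex.I * (γ / (16 * m) : ℝ) * (((a⁻¹ : ℝ) : ℂ) ^ 2 * (((‖ζ a‖ ^ 2 : ℝ) : ℂ) * P a)) with hr
  refine ⟨fun a => ζ a + (a⁻¹ : ℝ) * P a, r, ?_, ?_, ?_⟩
  · have := hinv.mul hPb
    simpa using this
  · have h1 : (fun a : ℝ => ((a⁻¹ : ℝ) : ℂ) * rest a) =O[atTop] fun a : ℝ => a⁻¹ ^ 2 :=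
      (hinv.mul hrestb).congr_right fun a => by ring
    have h2 : (fun a : ℝ => ((a⁻¹ : ℝ) : ℂ) ^ 2 * P a) =O[atTop] fun a : ℝ => a⁻¹ ^ 2 :=
      (hinv2.mul hPb).congr_right fun a => by ring
    have h3 : (fun a : ℝ => ((a⁻¹ : ℝ) : ℂ) ^ 2 * (((‖ζ a‖ ^ 2 : ℝ) : ℂ) * P a))
        =O[atTop] fun a : ℝ => a⁻¹ ^ 2 :=
      (hinv2.mul (one_mul_big hnorm hPb)).congr_right fun a => by ring
    exact ((hρ.add h1).sub h2).add (h3.const_mul_left _)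
  · filter_upwards [hζ, eventually_gt_atTop 0] with a ha ha0
    have hm' : (m : ℂ) ≠ 0 := by exact_mod_cast hm.ne'
    have haC : (a : ℂ) ≠ 0 := by exact_mod_cast ha0.ne'
    have hζd : HasDerivAt ζ (-(Complex.I * m * ζ a) + η a) a := ha.congr_deriv (by
      simp only [hη, hn]; ring)
    have hc : HasDerivAt (fun t => starRingEnd ℂ (ζ t))
        (starRingEnd ℂ (-(Complex.I * m * ζ a) + η a)) a := hζd.star
    have hPd := (hc.const_mul (Complex.I / (4 * m))).add
      ((((hζd.pow 3).neg.add ((hζd.const_mul 3).mul (hc.pow 2))).add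
        ((hc.pow 3).div_const 2)).const_mul ((γ / (96 * m ^ 2) : ℝ) : ℂ))
    have hid : HasDerivAt (fun a : ℝ => ((a⁻¹ : ℝ) : ℂ)) ((-(a ^ 2)⁻¹ : ℝ) : ℂ) a :=
      (hasDerivAt_inv ha0.ne').ofReal_comp
    have hZ := hζd.add (hid.mul hPd)
    refine HasDerivAt.congr_deriv (f := fun a => ζ a + (a⁻¹ : ℝ) * P a) hZ ?_
    have hnsq : ((‖ζ a‖ ^ 2 : ℝ) : ℂ) = ζ a * starRingEnd ℂ (ζ a) := by
      rw [Complex.mul_conj, Complex.normSq_eq_norm_sq]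
    have hre : ((ζ a).re : ℂ) = (ζ a + starRingEnd ℂ (ζ a)) / 2 := Complex.re_eq_add_conj _
    have hsplit : ((m + γ / (16 * m) * ‖ζ a‖ ^ 2 * a⁻¹ : ℝ) : ℂ)
        = m + γ / (16 * m) * ((‖ζ a‖ ^ 2 : ℝ) : ℂ) * (a : ℂ)⁻¹ := by push_cast; ring
    simp only [hr, hP, hrest, resonantCorrection, Pi.add_apply, Pi.mul_apply, Pi.neg_apply,
      Pi.pow_apply]
    rw [hsplit, hnsq]
    have hηa : η a = (a⁻¹ : ℝ) * (starRingEnd ℂ (ζ a) / 2 - Complex.I * γ / (6 * m) *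
        ((ζ a + starRingEnd ℂ (ζ a)) / 2) ^ 3) + ρ a := by rw [← hre]
    have hρa : ρ a = η a - (a⁻¹ : ℝ) * (starRingEnd ℂ (ζ a) / 2 - Complex.I * γ / (6 * m) *
        ((ζ a + starRingEnd ℂ (ζ a)) / 2) ^ 3) := by rw [hηa]; ring
    rw [hρa]
    simp only [map_add, map_neg, map_mul, Complex.conj_I, Complex.conj_ofReal]
    generalize starRingEnd ℂ (η a) = η'
    generalize η a = η₀
    generalize starRingEnd ℂ (ζ a) = w
    generalize ζ a = z
    push_cast
    field_simp
    ring_nf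
    simp only [Complex.I_sq]
    ring

end

/-- Asymptotics of a rotation perturbed at order `a⁻¹` by nonresonant terms and a resonant cubic
term, which produces a logarithmic phase shift. -/
theorem exists_resonant_asymptotics {ζ ρ : ℝ → ℂ} {m γ c₁ : ℝ} (hm : 0 < m)
    (hζ : ∀ᶠ a in atTop, HasDerivAt ζ (-(Complex.I * m * ζ a) + (a⁻¹ : ℝ) *
      (starRingEnd ℂ (ζ a) / 2 - Complex.I * γ / (6 * m) * ((ζ a).re : ℂ) ^ 3) + ρ a) a)
    (hρ : ρ =O[atTop] fun a : ℝ => a⁻¹ ^ 2) (hb : ζ =O[atTop] fun _ => (1 : ℝ))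
    (hc₁ : 0 < c₁) (hlow : ∀ᶠ a in atTop, c₁ ≤ ‖ζ a‖ ^ 2) :
    ∃ θ₀ E : ℝ, 0 < E ∧ (fun a => ζ a - (Real.sqrt (2 * E) : ℂ) *
      Complex.exp ((θ₀ - m * a - γ * E / (8 * m) * Real.log a : ℝ) * Complex.I))
        =O[atTop] fun a : ℝ => a⁻¹ := by
  obtain ⟨Z, r, hZζ, hr, hZ⟩ := exists_near_identity hm hζ hρ hb
  have hZb : Z =O[atTop] fun _ => (1 : ℝ) :=
    ((hZζ.trans isBigO_inv_one).add hb).congr_left fun a => by ring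
  -- the amplitude
  have hn : ∀ᶠ a in atTop, HasDerivAt (fun a => ‖Z a‖ ^ 2) (2 * inner ℝ (Z a) (r a)) a := by
    filter_upwards [hZ] with a ha
    refine ha.norm_sq.congr_deriv ?_
    rw [inner_add_right]
    -- A rotation is orthogonal to Z, so only the remainder changes the amplitude.
    have : inner ℝ (Z a) (-(Complex.I * (m + γ / (16 * m) * ‖ζ a‖ ^ 2 * a⁻¹ : ℝ)) * Z a) = 0 := by
      simp only [Complex.real_inner_eq, Complex.mul_re, Complex.mul_im, Complex.neg_re,
        Complex.neg_im, Complex.I_re, Complex.I_im, Complex.ofReal_re, Complex.ofReal_im]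
      ring
    rw [this, zero_add]
  have hn' : (fun a => 2 * inner ℝ (Z a) (r a)) =O[atTop] fun a : ℝ => a⁻¹ ^ 2 := by
    refine IsBigO.const_mul_left ?_ 2
    have h1 := hZb.norm_left.mul hr.norm_left
    simp only [one_mul] at h1
    refine (IsBigO.of_bound 1 (.of_forall fun a => ?_)).trans h1
    simpa using abs_real_inner_le_norm (Z a) (r a)
  obtain ⟨L, hL⟩ := exists_limit_of_deriv_isBigO hn hn'
  have hζL : (fun a => ‖ζ a‖ ^ 2 - L) =O[atTop] fun a : ℝ => a⁻¹ := by
    have h1 : (fun a => ‖ζ a‖ ^ 2 - ‖Z a‖ ^ 2) =O[atTop] fun a : ℝ => a⁻¹ := by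
      have h2 : (fun a => ‖ζ a‖ - ‖Z a‖) =O[atTop] fun a : ℝ => a⁻¹ :=
        (IsBigO.of_bound 1 (.of_forall fun a => by
          simpa [norm_sub_rev] using abs_norm_sub_norm_le (ζ a) (Z a))).trans hZζ
      have h3 := h2.mul (hb.norm_left.add hZb.norm_left)
      simp only [mul_one] at h3
      exact h3.congr_left fun a => by ring
    exact (h1.add hL).congr_left fun a => by ring
  have hLlim : Tendsto (fun a => ‖ζ a‖ ^ 2) atTop (𝓝 L) := by
    have := (hζL.trans_tendsto tendsto_inv_atTop_zero).add_const L
    simpa using this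
  have hLpos : 0 < L := hc₁.trans_le (ge_of_tendsto hLlim hlow)
  -- the phase
  set φ : ℝ → ℝ := fun a => m * a + γ / (16 * m) * L * Real.log a with hφ
  -- Unwinding with the limiting amplitude L leaves the frequency error (‖ζ‖² - L)/a, which is
  -- O(a⁻²).
  set Y : ℝ → ℂ := fun a => Complex.exp (φ a * Complex.I) * Z a with hY
  have hφd : ∀ a : ℝ, 0 < a → HasDerivAt φ (m + γ / (16 * m) * L * a⁻¹) a := fun a ha => by
    refine (((hasDerivAt_id a).const_mul m).add
      ((Real.hasDerivAt_log ha.ne').const_mul (γ / (16 * m) * L))).congr_deriv (by ring)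
  have hYd : ∀ᶠ a in atTop, HasDerivAt Y (Complex.exp (φ a * Complex.I) *
      (r a - Complex.I * (γ / (16 * m) : ℝ) * ((((‖ζ a‖ ^ 2 - L : ℝ) : ℂ) * (a⁻¹ : ℝ)) * Z a))) a := by
    filter_upwards [hZ, eventually_gt_atTop 0] with a ha ha0
    refine ((((hφd a ha0).ofReal_comp.mul_const Complex.I).cexp).mul ha).congr_deriv ?_
    push_cast
    ring
  have hexp : (fun a => Complex.exp (φ a * Complex.I)) =O[atTop] fun _ => (1 : ℝ) :=
    IsBigO.of_bound 1 (.of_forall fun a => by simp [Complex.norm_exp_ofReal_mul_I])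
  have hY' : (fun a => Complex.exp (φ a * Complex.I) *
      (r a - Complex.I * (γ / (16 * m) : ℝ) * ((((‖ζ a‖ ^ 2 - L : ℝ) : ℂ) * (a⁻¹ : ℝ)) * Z a)))
      =O[atTop] fun a : ℝ => a⁻¹ ^ 2 := by
    have h1 : (fun a => ((‖ζ a‖ ^ 2 - L : ℝ) : ℂ)) =O[atTop] fun a : ℝ => a⁻¹ :=
      (IsBigO.of_bound 1 (.of_forall fun a => by
        rw [Complex.norm_real, one_mul])).trans hζL
    have h2 : (fun a : ℝ => ((a⁻¹ : ℝ) : ℂ)) =O[atTop] fun a : ℝ => a⁻¹ :=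
      IsBigO.of_bound 1 (.of_forall fun a => by simp)
    have h3 := ((h1.mul h2).mul hZb).congr_right (g₂ := fun a : ℝ => a⁻¹ ^ 2) fun a => by ring
    have h4 := hexp.mul (hr.sub (h3.const_mul_left (Complex.I * (γ / (16 * m) : ℝ))))
    exact h4.congr_right fun a => by ring
  obtain ⟨y, hy⟩ := exists_limit_of_deriv_isBigO hYd hY'
  have hYlim : Tendsto (fun a => ‖Y a‖ ^ 2) atTop (𝓝 (‖y‖ ^ 2)) := by
    have h1 := (hy.trans_tendsto tendsto_inv_atTop_zero).add_const y
    simp only [sub_add_cancel, zero_add] at h1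
    exact h1.norm.pow 2
  have hZlim : Tendsto (fun a => ‖Y a‖ ^ 2) atTop (𝓝 L) := by
    have h1 := (hL.trans_tendsto tendsto_inv_atTop_zero).add_const L
    simpa [hY, Complex.norm_exp_ofReal_mul_I] using h1
  have hyL : ‖y‖ = Real.sqrt L := by
    rw [← tendsto_nhds_unique hYlim hZlim, Real.sqrt_sq (norm_nonneg _)]
  -- E is half the limit of ‖ζ‖², so γL/(16m) = γE/(8m).
  refine ⟨y.arg, L / 2, by positivity, ?_⟩
  have hyp : y = (Real.sqrt L : ℂ) * Complex.exp (y.arg * Complex.I) := by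
    rw [← hyL, Complex.norm_mul_exp_arg_mul_I]
  have hexp' : (fun a => Complex.exp (-(φ a * Complex.I))) =O[atTop] fun _ => (1 : ℝ) :=
    IsBigO.of_bound 1 (.of_forall fun a => by
      rw [← neg_mul, ← Complex.ofReal_neg, Complex.norm_exp_ofReal_mul_I]; simp)
  have h1 := hexp'.mul hy
  simp only [one_mul] at h1
  refine (h1.sub hZζ).congr_left fun a => ?_
  have e1 : Complex.exp (-(φ a * Complex.I)) * Y a = Z a := by
    rw [hY, ← mul_assoc, ← Complex.exp_add]; simp
  have e2 : Complex.exp (-(φ a * Complex.I)) * y = (Real.sqrt (2 * (L / 2)) : ℂ) *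
      Complex.exp ((y.arg - m * a - γ * (L / 2) / (8 * m) * Real.log a : ℝ) * Complex.I) := by
    conv_lhs => rw [hyp]
    rw [show 2 * (L / 2) = L by ring, mul_left_comm, ← Complex.exp_add]
    congr 2
    simp only [hφ]
    have hm' : (m : ℂ) ≠ 0 := by exact_mod_cast hm.ne'
    push_cast
    field_simp
    ring
  rw [mul_sub, e1, e2]
  ring

namespace DampedPendulum

variable {Γ F s v : ℝ → ℝ} {m γ κ K T C R a₁ : ℝ}

/-- The complex amplitude `√a (m s + i v)`. -/
def amplitude (s v : ℝ → ℝ) (m a : ℝ) : ℂ :=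
  ((Real.sqrt a * (m * s a) : ℝ) : ℂ) + ((Real.sqrt a * v a : ℝ) : ℂ) * Complex.I

/-- Differentiating √a gives ζ/(2a), and the damping subtracts twice the imaginary part of that,
leaving ζ̄/(2a). The cubic term of `Γ` becomes γ(Re ζ)³/(6ma); the rest is O(a⁻²) because √a |s| is
bounded. -/
theorem exists_amplitude_equation (h : DampedPendulum Γ F s v m γ κ K T C R a₁) :
    ∃ ρ : ℝ → ℂ, ρ =O[atTop] (fun a : ℝ => a⁻¹ ^ 2) ∧
      ∀ᶠ a in atTop, HasDerivAt (amplitude s v m) (-(Complex.I * m * amplitude s v m a)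
        + (a⁻¹ : ℝ) * (starRingEnd ℂ (amplitude s v m a) / 2
          - Complex.I * γ / (6 * m) * ((amplitude s v m a).re : ℂ) ^ 3) + ρ a) a := by
  have hm := h.m_pos
  obtain ⟨a₂, c₁, c₂, ha₂, -, hdec⟩ := h.exists_decay
  choose! e he hv using h.hasDerivAt_v
  have hre : ∀ a, (amplitude s v m a).re = Real.sqrt a * (m * s a) := fun a => by simp [amplitude]
  refine ⟨fun a => -(Complex.I * (Real.sqrt a *
    (m ^ 2 * (Γ (s a) - s a - γ / 6 * s a ^ 3) + e a) : ℝ)), ?_, ?_⟩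
  · refine IsBigO.of_bound (m ^ 2 * (T * Real.sqrt c₂ ^ 5) + C * Real.sqrt c₂) ?_
    filter_upwards [eventually_gt_atTop a₂] with a ha
    have ha1 := ha₂.trans_lt ha
    have ha0 : 0 < a := by linarith [h.one_le]
    have hT := h.T_nonneg
    have hC := h.C_nonneg
    have hsq : 0 < Real.sqrt a := Real.sqrt_pos.2 ha0
    have hsq2 : Real.sqrt a ^ 2 = a := Real.sq_sqrt ha0.le
    have hle : Real.sqrt a * |s a| ≤ Real.sqrt c₂ := by
      apply Real.le_sqrt_of_sq_le
      rw [mul_pow, hsq2, sq_abs]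
      have := (hdec a ha.le).2
      have : 0 ≤ a * v a ^ 2 := by positivity
      linarith
    have h1 := h.abs_cubic_le _ (h.abs_le a ha1)
    have h2 := he a ha1
    rw [norm_neg, norm_mul, Complex.norm_I, one_mul, Complex.norm_real, Real.norm_eq_abs, abs_mul,
      abs_of_pos hsq, Real.norm_of_nonneg (by positivity)]
    calc _ ≤ Real.sqrt a * (m ^ 2 * (T * |s a| ^ 5) + C * |s a| / a ^ 2) := by
          gcongr
          refine (abs_add_le _ _).trans (add_le_add ?_ h2)
          rw [abs_mul, abs_of_nonneg (sq_nonneg m)]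
          gcongr
      _ = (m ^ 2 * (T * (Real.sqrt a * |s a|) ^ 5) + C * (Real.sqrt a * |s a|)) * a⁻¹ ^ 2 := by
          rw [mul_pow, show Real.sqrt a ^ 5 = (Real.sqrt a ^ 2) ^ 2 * Real.sqrt a by ring, hsq2]
          field_simp
      _ ≤ _ := by gcongr
  · filter_upwards [eventually_gt_atTop a₂] with a ha
    have ha1 := ha₂.trans_lt ha
    have ha0 : 0 < a := by linarith [h.one_le]
    have hsq : 0 < Real.sqrt a := Real.sqrt_pos.2 ha0
    have hsq2 : Real.sqrt a ^ 2 = a := Real.sq_sqrt ha0.le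
    have hsqd := Real.hasDerivAt_sqrt ha0.ne'
    have d1 := (hsqd.mul ((h.hasDerivAt_s a ha1).const_mul m)).ofReal_comp
    have d2 := ((hsqd.mul (hv a ha1)).ofReal_comp).mul_const Complex.I
    refine HasDerivAt.congr_deriv (f := amplitude s v m) (d1.add d2) ?_
    have hconj : starRingEnd ℂ (amplitude s v m a) =
        (Real.sqrt a : ℂ) * (m * s a) - (Real.sqrt a : ℂ) * v a * Complex.I := by
      simp [amplitude]; ring
    have haq : (a : ℂ) = (Real.sqrt a : ℂ) ^ 2 := by exact_mod_cast hsq2.symm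
    have hq0 : (Real.sqrt a : ℂ) ≠ 0 := by exact_mod_cast hsq.ne'
    have hm' : (m : ℂ) ≠ 0 := by exact_mod_cast hm.ne'
    rw [hconj, hre, amplitude]
    push_cast
    rw [haq]
    generalize (Real.sqrt a : ℂ) = q at *
    field_simp
    ring_nf
    simp only [Complex.I_sq]
    ring

theorem exists_asymptotics (h : DampedPendulum Γ F s v m γ κ K T C R a₁) :
    ∃ θ₀ E : ℝ, 0 < E ∧
      (fun a => Real.sqrt a * (m * s a) - Real.sqrt (2 * E) *
        Real.cos (θ₀ - m * a - γ * E / (8 * m) * Real.log a)) =O[atTop] (fun a : ℝ => a⁻¹) ∧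
      (fun a => Real.sqrt a * v a - Real.sqrt (2 * E) *
        Real.sin (θ₀ - m * a - γ * E / (8 * m) * Real.log a)) =O[atTop] (fun a : ℝ => a⁻¹) := by
  have hm := h.m_pos
  obtain ⟨a₂, c₁, c₂, ha₂, hc₁, hdec⟩ := h.exists_decay
  obtain ⟨ρ, hρ, hζ⟩ := h.exists_amplitude_equation
  have hnorm : ∀ a, 0 ≤ a → ‖amplitude s v m a‖ ^ 2 = a * (m ^ 2 * s a ^ 2 + v a ^ 2) := by
    intro a ha
    rw [Complex.sq_norm_eq_re_im]
    simp [amplitude, mul_pow, Real.sq_sqrt ha]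
    ring
  have hb : amplitude s v m =O[atTop] fun _ => (1 : ℝ) := by
    refine IsBigO.of_bound (Real.sqrt ((m ^ 2 + 1) * c₂)) ?_
    filter_upwards [eventually_ge_atTop a₂] with a ha
    have ha0 : 0 ≤ a := by linarith [h.one_le]
    rw [norm_one, mul_one]
    apply Real.le_sqrt_of_sq_le
    rw [hnorm a ha0]
    calc a * (m ^ 2 * s a ^ 2 + v a ^ 2) ≤ (m ^ 2 + 1) * (a * (s a ^ 2 + v a ^ 2)) := by
          have : 0 ≤ a * (s a ^ 2 + m ^ 2 * v a ^ 2) := by positivity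
          linarith
      _ ≤ _ := by
          have := (hdec a ha).2
          gcongr
  have hlow : ∀ᶠ a in atTop, min (m ^ 2) 1 * c₁ ≤ ‖amplitude s v m a‖ ^ 2 := by
    filter_upwards [eventually_ge_atTop a₂] with a ha
    have ha0 : 0 ≤ a := by linarith [h.one_le]
    rw [hnorm a ha0]
    have h1 := (hdec a ha).1
    calc min (m ^ 2) 1 * c₁ ≤ min (m ^ 2) 1 * (a * (s a ^ 2 + v a ^ 2)) := by gcongr
      _ = a * (min (m ^ 2) 1 * s a ^ 2 + min (m ^ 2) 1 * v a ^ 2) := by ring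
      _ ≤ a * (m ^ 2 * s a ^ 2 + 1 * v a ^ 2) := by
          gcongr
          · exact min_le_left _ _
          · exact min_le_right _ _
      _ = _ := by ring
  obtain ⟨θ₀, E, hE, hO⟩ := exists_resonant_asymptotics hm hζ hρ hb (by positivity) hlow
  refine ⟨θ₀, E, hE, ?_, ?_⟩
  · refine (IsBigO.of_bound 1 (.of_forall fun a => ?_)).trans hO
    rw [one_mul]
    refine le_trans (le_of_eq ?_) (Complex.abs_re_le_norm _)
    rw [Complex.sub_re, Complex.re_ofReal_mul, Complex.exp_ofReal_mul_I_re]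
    simp [amplitude]
  · refine (IsBigO.of_bound 1 (.of_forall fun a => ?_)).trans hO
    rw [one_mul]
    refine le_trans (le_of_eq ?_) (Complex.abs_im_le_norm _)
    rw [Complex.sub_im, Complex.im_ofReal_mul, Complex.exp_ofReal_mul_I_im]
    simp [amplitude]

end DampedPendulum

theorem rpow_neg_three_halves {a : ℝ} (ha : 0 < a) :
    a ^ (-(3 / 2) : ℝ) = a⁻¹ * (Real.sqrt a)⁻¹ := by
  rw [Real.sqrt_eq_rpow, ← Real.rpow_neg_one, ← Real.rpow_neg ha.le, ← Real.rpow_add ha]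
  norm_num

theorem rpow_neg_five_halves {a : ℝ} (ha : 0 < a) :
    a ^ (-(5 / 2) : ℝ) = a⁻¹ * (a⁻¹ * (Real.sqrt a)⁻¹) := by
  rw [← rpow_neg_three_halves ha, ← Real.rpow_neg_one, ← Real.rpow_add ha]
  norm_num

/-! ### Return to the surface -/

namespace RevolutionSurface

variable {N : RevolutionSurface} {μ k b c : ℝ} {W : ℝ → N.Point} {s β : ℝ → ℝ}

/-- Near the center, `F / Γ` agrees with `s / 2` up to a cubic error. -/
theorem exists_abs_sigma_add_le {R : ℝ} (hR : ENNReal.ofReal R < N.radius)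
    (hσ : ∀ a, 0 < a → N.sigma s β a = -(c * N.F (s a)) / (a * N.Γ (s a))) :
    ∃ B, 0 ≤ B ∧ ∀ a, 0 < a → |s a| ≤ R →
      |N.sigma s β a + c / (2 * a) * s a| ≤ B * |s a| ^ 3 / a := by
  obtain ⟨κ, K, hκ, hκK, hbd⟩ := N.exists_bounds hR
  obtain ⟨T, hT, hcub⟩ := N.exists_cubic_bounds R
  refine ⟨|c| * (3 / 2 * T) / κ, by positivity, fun a ha hsa => ?_⟩
  rcases eq_or_ne (s a) 0 with h0 | h0
  · simp [sigma, h0]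
  have hs0 : 0 < |s a| := abs_pos.2 h0
  have hΓle := (hbd _ hsa).2.1
  have hΓ0 : 0 < |N.Γ (s a)| := lt_of_lt_of_le (by positivity) hΓle
  have hΓ : N.Γ (s a) ≠ 0 := abs_pos.1 hΓ0
  obtain ⟨-, h1, h2⟩ := hcub _ hsa
  have e : N.sigma s β a + c / (2 * a) * s a = -(c * ((N.F (s a) - s a ^ 2 / 2)
      - s a * (N.Γ (s a) - s a) / 2)) / (a * N.Γ (s a)) := by
    rw [hσ a ha]; field_simp; ring
  have h3 : |(N.F (s a) - s a ^ 2 / 2) - s a * (N.Γ (s a) - s a) / 2| ≤ 3 / 2 * T * |s a| ^ 4 := by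
    refine (abs_sub _ _).trans ?_
    rw [abs_div, abs_mul, abs_of_pos (by norm_num : (0 : ℝ) < 2)]
    rw [← Even.pow_abs (show Even 4 by decide)] at h2
    have : |s a| * |N.Γ (s a) - s a| ≤ |s a| * (T * |s a| ^ 3) := by gcongr
    linarith
  rw [e, abs_div, abs_neg, abs_mul, abs_mul, abs_of_pos ha]
  calc _ ≤ |c| * (3 / 2 * T * |s a| ^ 4) / (a * (κ * |s a|)) := by gcongr
    _ = _ := by field_simp

end RevolutionSurface

theorem proposition4p2 (N : RevolutionSurface) (μ k b c : ℝ)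
    (hμ : μ < 0) (hc : c ^ 2 < -4 * (b * k + k ^ 2))
    (W : ℝ → N.Point) (s β : ℝ → ℝ)
    (hW : N.IsSolutionOn μ k b c W (Set.Ioi 0))
    (hlift : N.IsPolarLift W s β (Set.Ioi 0))
    (hW0 : Tendsto W (𝓝[>] 0) (𝓝 N.origin))
    (hWa0 : Tendsto (fun a => a * N.speed s β a) (𝓝[>] 0) (𝓝 0))
    (hnontrivial : ∃ a, 0 < a ∧ W a ≠ N.origin)
    (hA1 : limsup (fun a => ENNReal.ofReal |s a|) atTop < N.radius) :
    ∃ θ₀ E : ℝ, 0 < E ∧ ∃ θ : ℝ → ℝ,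
      (fun a => θ a - (θ₀ - Real.sqrt (-μ) * a
          - (Real.sqrt (-μ))⁻¹ * iteratedDeriv 3 N.Γ 0 * E / 8 * Real.log a))
        =O[atTop] (fun a : ℝ => a⁻¹) ∧
      (fun a => s a - Real.sqrt (-2 * E / (a * μ)) * Real.cos (θ a))
        =O[atTop] (fun a : ℝ => a ^ (-(3 / 2) : ℝ)) ∧
      (fun a => deriv s a - Real.sqrt (2 * E / a) * Real.sin (θ a))
        =O[atTop] (fun a : ℝ => a ^ (-(3 / 2) : ℝ)) ∧
      (fun a => N.sigma s β a - -c * Real.sqrt (-E / (2 * a ^ 3 * μ)) * Real.cos (θ a))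
        =O[atTop] (fun a : ℝ => a ^ (-(5 / 2) : ℝ)) ∧
      ∀ a, 0 < a → N.sigma s β a = -(c * N.F (s a)) / (a * N.Γ (s a)) := by
  have hσ : ∀ a, 0 < a → N.sigma s β a = -(c * N.F (s a)) / (a * N.Γ (s a)) := fun a ha =>
    RevolutionSurface.sigma_eq_of_momentum_eq ha (hW.momentum_eq hlift hW0 hWa0 ha)
  obtain ⟨R, hR, hsR⟩ := RevolutionSurface.exists_radius_of_limsup_lt hA1
  obtain ⟨a₀, ha₀⟩ := eventually_atTop.1 hsR
  obtain ⟨C, hC, hpend⟩ := hW.exists_pendulum hμ hlift hnontrivial hσ hR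
  obtain ⟨κ, K, hκ, hκK, hbd⟩ := N.exists_bounds hR
  obtain ⟨T, hT, hcub⟩ := N.exists_cubic_bounds R
  obtain ⟨B, hB, hσs⟩ := RevolutionSurface.exists_abs_sigma_add_le hR hσ
  set m := Real.sqrt (-μ) with hmdef
  set γ := iteratedDeriv 3 N.Γ 0
  have hm : 0 < m := Real.sqrt_pos.2 (by linarith)
  have hm2 : m ^ 2 = -μ := Real.sq_sqrt (by linarith)
  have hpos : ∀ a, max a₀ 1 < a → 0 < a := fun a ha => by
    linarith [(le_max_right a₀ 1).trans_lt ha]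
  have hP : DampedPendulum N.Γ N.F s (deriv s) m γ κ K T C R (max a₀ 1) :=
    { m_pos := hm
      κ_pos := hκ
      κ_le := hκK
      T_nonneg := hT
      C_nonneg := hC
      one_le := le_max_right _ _
      hasDerivAt_F := N.hasDerivAt_F
      le_mul_Γ := fun x hx => (hbd x hx).1
      le_F := fun x hx => (hbd x hx).2.2.2.1
      F_le := fun x hx => (hbd x hx).2.2.2.2
      abs_cubic_le := fun x hx => (hcub x hx).1
      abs_linear_le := fun x hx => (hcub x hx).2.1
      abs_F_le := fun x hx => (hcub x hx).2.2
      abs_le := fun a ha => ha₀ a ((le_max_left _ _).trans ha.le)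
      -- If s and s' vanished together, so would σ = Γ(s)β_a and hence the energy.
      pos := fun a ha => by
        have hE := hW.energy_pos hμ hlift hnontrivial (hpos a ha)
        by_contra hle
        have h1 : s a = 0 := by nlinarith [sq_nonneg (s a), sq_nonneg (deriv s a)]
        have h2 : deriv s a = 0 := by nlinarith [sq_nonneg (s a), sq_nonneg (deriv s a)]
        simp [RevolutionSurface.sigma, h1, h2] at hE
      hasDerivAt_s := fun a ha => (hlift a (hpos a ha)).1.hasDerivAt
      hasDerivAt_v := fun a ha => by
        obtain ⟨e, he, hd⟩ := hpend a (hpos a ha) (by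
          filter_upwards [lt_mem_nhds ((le_max_left _ _).trans_lt ha)] with t ht
            using ha₀ t ht.le)
        exact ⟨e, he, hd.congr_deriv (by rw [hm2]; ring)⟩ }
  obtain ⟨θ₀, E, hE, hs, hv⟩ := hP.exists_asymptotics
  obtain ⟨a₂, c₁, c₂, ha₂, -, hdec⟩ := hP.exists_decay
  set θ : ℝ → ℝ := fun a => θ₀ - m * a - γ * E / (8 * m) * Real.log a with hθ
  replace hs : (fun a => Real.sqrt a * (m * s a) - Real.sqrt (2 * E) * Real.cos (θ a))
      =O[atTop] (fun a : ℝ => a⁻¹) := hs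
  replace hv : (fun a => Real.sqrt a * deriv s a - Real.sqrt (2 * E) * Real.sin (θ a))
      =O[atTop] (fun a : ℝ => a⁻¹) := hv
  have hsqrt : ∀ a, 0 < a →
      Real.sqrt (-2 * E / (a * μ)) = Real.sqrt (2 * E) * (m * Real.sqrt a)⁻¹ := by
    intro a ha
    rw [show -2 * E / (a * μ) = 2 * E / (m ^ 2 * a) by
      rw [hm2]; have := hμ.ne; field_simp, Real.sqrt_div (by positivity),
      Real.sqrt_mul (sq_nonneg m), Real.sqrt_sq hm.le, div_eq_mul_inv]
  have hrpow : (fun a : ℝ => a⁻¹ * (Real.sqrt a)⁻¹) =ᶠ[atTop] fun a : ℝ => a ^ (-(3 / 2) : ℝ) := by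
    filter_upwards [eventually_gt_atTop 0] with a ha using (rpow_neg_three_halves ha).symm
  have hrpow' : (fun a : ℝ => a⁻¹ * (a⁻¹ * (Real.sqrt a)⁻¹)) =ᶠ[atTop]
      fun a : ℝ => a ^ (-(5 / 2) : ℝ) := by
    filter_upwards [eventually_gt_atTop 0] with a ha using (rpow_neg_five_halves ha).symm
  have hs' : (fun a => s a - Real.sqrt (-2 * E / (a * μ)) * Real.cos (θ a))
      =O[atTop] fun a : ℝ => a⁻¹ * (Real.sqrt a)⁻¹ := by
    refine ((hs.mul (isBigO_refl (fun a : ℝ => (Real.sqrt a)⁻¹) atTop)).const_mul_left m⁻¹).congr'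
      ?_ EventuallyEq.rfl
    filter_upwards [eventually_gt_atTop 0] with a ha
    have := Real.sqrt_pos.2 ha
    rw [hsqrt a ha]
    field_simp
  refine ⟨θ₀, E, hE, θ, ?_, ?_, ?_, ?_, hσ⟩
  -- The phase is taken equal to its expansion, so its error is zero.
  · refine (isBigO_zero _ _).congr_left fun a => ?_
    simp only [hθ]
    field_simp
    ring
  · exact hs'.congr' EventuallyEq.rfl hrpow
  · refine (hv.mul (isBigO_refl (fun a : ℝ => (Real.sqrt a)⁻¹) atTop)).congr' ?_ hrpow
    filter_upwards [eventually_gt_atTop 0] with a ha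
    have := Real.sqrt_pos.2 ha
    rw [Real.sqrt_div (by positivity)]
    field_simp
  -- σ = -cs/(2a) + O(|s|³/a) and |s| = O(a^{-1/2}), so the expansion of s carries over with one
  -- more factor a⁻¹.
  · have h1 : (fun a => N.sigma s β a + c / (2 * a) * s a) =O[atTop]
        fun a : ℝ => a⁻¹ * (a⁻¹ * (Real.sqrt a)⁻¹) := by
      refine IsBigO.of_bound (B * Real.sqrt c₂ ^ 3) ?_
      filter_upwards [eventually_gt_atTop a₂] with a ha
      have ha1 := ha₂.trans_lt ha
      have ha0 := hpos a ha1
      have hq := Real.sqrt_pos.2 ha0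
      have hq2 : Real.sqrt a ^ 2 = a := Real.sq_sqrt ha0.le
      have hle : Real.sqrt a * |s a| ≤ Real.sqrt c₂ := by
        apply Real.le_sqrt_of_sq_le
        rw [mul_pow, hq2, sq_abs]
        have := (hdec a ha.le).2
        have : 0 ≤ a * deriv s a ^ 2 := by positivity
        linarith
      rw [Real.norm_eq_abs, Real.norm_of_nonneg (by positivity)]
      refine (hσs a ha0 (hP.abs_le a ha1)).trans ?_
      calc B * |s a| ^ 3 / a
          = B * (Real.sqrt a * |s a|) ^ 3 * (a⁻¹ * ((Real.sqrt a ^ 2)⁻¹ * (Real.sqrt a)⁻¹)) := by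
            field_simp
        _ = B * (Real.sqrt a * |s a|) ^ 3 * (a⁻¹ * (a⁻¹ * (Real.sqrt a)⁻¹)) := by rw [hq2]
        _ ≤ _ := by gcongr
    have h2 := ((isBigO_refl (fun a : ℝ => a⁻¹) atTop).mul hs').const_mul_left (c / 2)
    refine (h1.sub h2).congr' ?_ hrpow'
    filter_upwards [eventually_gt_atTop 0] with a ha
    have e : Real.sqrt (-E / (2 * a ^ 3 * μ)) = (2 * a)⁻¹ * Real.sqrt (-2 * E / (a * μ)) := by
      rw [show -E / (2 * a ^ 3 * μ) = ((2 * a)⁻¹) ^ 2 * (-2 * E / (a * μ)) by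
        have := hμ.ne; field_simp, Real.sqrt_mul (sq_nonneg _),
        Real.sqrt_sq (by positivity)]
    rw [e]
    field_simp
    ring

end
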